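/- Let $K$ be a field and let $C$ be a $K$-coalgebra, with dual algebra $C^*$ (convolution product). Right $C$-comodules are regarded as left $C^*$-modules via $f\cdot m=\sum f(m_1)m_0$, and left $C$-comodules as right $C^*$-modules via $m\cdot f=\sum f(m_{-1})m_0$. For a module $M$ over a ring, let $L_0(M)=0$ and let $L_{n+1}(M)/L_n(M)$ be the socle of $M/L_n(M)$; $M$ has finite Loewy length if $L_n(M)=M$ for some natural number $n$. Theorem 3.4. Suppose that $C$ generates its right comodules, i.e. every right $C$-comodule is a quotient of a direct sum of copies of the right comodule $C$. Then the following conditions are equivalent: (i) the injective envelope (in the category of left $C$-comodules) of every simple left $C$-comodule has finite Loewy length; (ii) $C$ is right semiperfect, i.e. every finite dimensional right $C$-comodule has a projective cover in the category of right $C$-comodules; (iii) $C$ is right QcF (quasi-co-Frobenius), i.e. $C$ embeds, as a right $C^*$-module, in a direct sum of copies of $C^*$. Moreover, these conditions hold if $C$ has finite coradical filtration, i.e. if $C=C_n$ for some $n\ge 0$, where $C_n=L_{n+1}(C)$, with $C$ regarded as a right comodule over itself. -/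

import Mathlib

open scoped TensorProduct MulOpposite

universe u

namespace ComoduleTheory

/-! ### Loewy series of modules -/

section Loewy

/-- The socle of a module: the sum of all its simple submodules. -/
def socle (R M : Type*) [Ring R] [AddCommGroup M] [Module R M] : Submodule R M :=
  sSup {N : Submodule R M | IsSimpleModule R N}

/-- The (finite part of the) Loewy series: `L₀(M) = 0`, and `Lₙ₊₁(M)` is the submodule containing
`Lₙ(M)` with `Lₙ₊₁(M) / Lₙ(M)` the socle of `M / Lₙ(M)`. -/
def loewySeries (R M : Type*) [Ring R] [AddCommGroup M] [Module R M] : ℕ → Submodule R M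
  | 0 => ⊥
  | n + 1 => (socle R (M ⧸ loewySeries R M n)).comap (loewySeries R M n).mkQ

/-- `M` has finite Loewy length: `Lₙ(M) = M` for some natural number `n`. -/
def HasFiniteLoewyLength (R M : Type*) [Ring R] [AddCommGroup M] [Module R M] : Prop :=
  ∃ n : ℕ, loewySeries R M n = ⊤

end Loewy

/-- The dual algebra `C^*` of a coalgebra, with the convolution product
`(f * g)(c) = f(c₁) g(c₂)` and unit the counit. -/
abbrev DualAlgebra (K C : Type*) [Field K] [AddCommGroup C] [Module K C] [Coalgebra K C] :=
  WithConv (C →ₗ[K] K)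

section Defs

variable (K C : Type*) [Field K] [AddCommGroup C] [Module K C] [Coalgebra K C]

/-! ### Comodules -/

/-- A right `C`-comodule structure on a vector space `M`: a coassociative and counital coaction
`ρ : M → M ⊗ C`. -/
class RightComodule (M : Type*) [AddCommGroup M] [Module K M] where
  /-- the coaction `m ↦ m₀ ⊗ m₁` -/
  coact : M →ₗ[K] M ⊗[K] C
  coassoc : (TensorProduct.assoc K M C C).toLinearMap ∘ₗ coact.rTensor C ∘ₗ coact =
    (Coalgebra.comul (R := K) (A := C)).lTensor M ∘ₗ coact
  counit_coact : (Coalgebra.counit (R := K) (A := C)).lTensor M ∘ₗ coact =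
    (TensorProduct.mk K M K).flip 1

/-- A left `C`-comodule structure on a vector space `M`: a coassociative and counital coaction
`ρ : M → C ⊗ M`. -/
class LeftComodule (M : Type*) [AddCommGroup M] [Module K M] where
  /-- the coaction `m ↦ m₋₁ ⊗ m₀` -/
  coact : M →ₗ[K] C ⊗[K] M
  coassoc : (TensorProduct.assoc K C C M).toLinearMap ∘ₗ
      (Coalgebra.comul (R := K) (A := C)).rTensor M ∘ₗ coact =
    coact.lTensor C ∘ₗ coact
  counit_coact : (Coalgebra.counit (R := K) (A := C)).rTensor M ∘ₗ coact =
    TensorProduct.mk K K M 1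

/-- `C` as a right comodule over itself. -/
instance RightComodule.self : RightComodule K C C where
  coact := Coalgebra.comul
  coassoc := Coalgebra.coassoc
  counit_coact := Coalgebra.lTensor_counit_comp_comul

/-- `C` as a left comodule over itself. -/
instance LeftComodule.self : LeftComodule K C C where
  coact := Coalgebra.comul
  coassoc := Coalgebra.coassoc
  counit_coact := Coalgebra.rTensor_counit_comp_comul

section RightDefs

variable (M N : Type*) [AddCommGroup M] [Module K M] [RightComodule K C M]
  [AddCommGroup N] [Module K N] [RightComodule K C N]

/-- The left `C^*`-module structure of a right comodule: `f • m = f(m₁) m₀`. -/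
instance RightComodule.toModule : Module (DualAlgebra K C) M where
  smul f m := TensorProduct.rid K M (f.ofConv.lTensor M (RightComodule.coact m))
  one_smul m := by
    have h := LinearMap.congr_fun (RightComodule.counit_coact (K := K) (C := C) (M := M)) m
    simp only [LinearMap.comp_apply, LinearMap.flip_apply, TensorProduct.mk_apply] at h
    have h1 : (1 : DualAlgebra K C).ofConv = Coalgebra.counit := by
      ext c; simp
    change TensorProduct.rid K M ((1 : DualAlgebra K C).ofConv.lTensor M _) = m
    rw [h1, h]; simp
  mul_smul f g m := by
    have h := LinearMap.congr_fun (RightComodule.coassoc (K := K) (C := C) (M := M)) m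
    simp only [LinearMap.comp_apply, LinearEquiv.coe_coe] at h
    let Φ : M ⊗[K] (C ⊗[K] C) →ₗ[K] M := (TensorProduct.rid K M).toLinearMap ∘ₗ
      (LinearMap.mul' K K ∘ₗ TensorProduct.map f.ofConv g.ofConv).lTensor M
    have h1 : ∀ t : M ⊗[K] C, Φ ((Coalgebra.comul (R := K) (A := C)).lTensor M t) =
        TensorProduct.rid K M ((f * g).ofConv.lTensor M t) := by
      intro t
      induction t with
      | zero => simp
      | add x y hx hy => simp only [map_add, hx, hy]
      | tmul x c => simp [Φ, LinearMap.convMul_apply]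
    have h2 : ∀ t : M ⊗[K] C, Φ (TensorProduct.assoc K M C C (RightComodule.coact.rTensor C t)) =
        TensorProduct.rid K M (f.ofConv.lTensor M
          (RightComodule.coact (TensorProduct.rid K M (g.ofConv.lTensor M t)))) := by
      intro t
      induction t with
      | zero => simp
      | add x y hx hy => simp only [map_add, hx, hy]
      | tmul x c =>
        simp only [LinearMap.rTensor_tmul, LinearMap.lTensor_tmul, TensorProduct.rid_tmul, map_smul]
        generalize (RightComodule.coact x : M ⊗[K] C) = s
        induction s with
        | zero => simp
        | add x y hx hy => simp only [map_add, TensorProduct.add_tmul, smul_add, hx, hy]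
        | tmul y d => simp [Φ, smul_smul, mul_comm]
    exact ((h1 _).symm.trans (congrArg Φ h.symm)).trans (h2 _)
  smul_zero f := by
    change TensorProduct.rid K M (f.ofConv.lTensor M (RightComodule.coact (0 : M))) = 0
    simp
  smul_add f x y := by
    change TensorProduct.rid K M (f.ofConv.lTensor M (RightComodule.coact (x + y))) =
      TensorProduct.rid K M (f.ofConv.lTensor M (RightComodule.coact x)) +
        TensorProduct.rid K M (f.ofConv.lTensor M (RightComodule.coact y))
    simp
  add_smul f g x := by
    change TensorProduct.rid K M ((f + g).ofConv.lTensor M (RightComodule.coact x)) =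
      TensorProduct.rid K M (f.ofConv.lTensor M (RightComodule.coact x)) +
        TensorProduct.rid K M (g.ofConv.lTensor M (RightComodule.coact x))
    simp [LinearMap.lTensor_add]
  zero_smul x := by
    change TensorProduct.rid K M ((0 : DualAlgebra K C).ofConv.lTensor M
      (RightComodule.coact x)) = 0
    simp

variable {M N}

/-- `φ` is a morphism of right comodules: `ρ(φ(m)) = φ(m₀) ⊗ m₁`. -/
def IsRightHom (φ : M →ₗ[K] N) : Prop :=
  (RightComodule.coact : N →ₗ[K] N ⊗[K] C) ∘ₗ φ =
    φ.rTensor C ∘ₗ (RightComodule.coact : M →ₗ[K] M ⊗[K] C)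

/-- `X` is a subcomodule of the right comodule `M`: `ρ(X) ⊆ X ⊗ C`. -/
def IsRightSubcomodule (X : Submodule K M) : Prop :=
  X.map (RightComodule.coact : M →ₗ[K] M ⊗[K] C) ≤ LinearMap.range (X.subtype.rTensor C)

end RightDefs

section LeftDefs

variable (M N : Type*) [AddCommGroup M] [Module K M] [LeftComodule K C M]
  [AddCommGroup N] [Module K N] [LeftComodule K C N]

/-- The right `C^*`-module structure of a left comodule: `m • f = f(m₋₁) m₀`. -/
instance LeftComodule.toModule : Module (DualAlgebra K C)ᵐᵒᵖ M where
  smul f m := TensorProduct.lid K M (f.unop.ofConv.rTensor M (LeftComodule.coact m))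
  one_smul m := by
    have h := LinearMap.congr_fun (LeftComodule.counit_coact (K := K) (C := C) (M := M)) m
    simp only [LinearMap.comp_apply, TensorProduct.mk_apply] at h
    have h1 : (1 : (DualAlgebra K C)ᵐᵒᵖ).unop.ofConv = Coalgebra.counit := by
      ext c; simp
    change TensorProduct.lid K M ((1 : (DualAlgebra K C)ᵐᵒᵖ).unop.ofConv.rTensor M _) = m
    rw [h1, h]; simp
  mul_smul f g m := by
    have h := LinearMap.congr_fun (LeftComodule.coassoc (K := K) (C := C) (M := M)) m
    simp only [LinearMap.comp_apply, LinearEquiv.coe_coe] at h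
    let Φ : C ⊗[K] (C ⊗[K] M) →ₗ[K] M := (TensorProduct.lid K M).toLinearMap ∘ₗ
      (LinearMap.mul' K K ∘ₗ TensorProduct.map g.unop.ofConv f.unop.ofConv).rTensor M ∘ₗ
      (TensorProduct.assoc K C C M).symm.toLinearMap
    have h1 : ∀ t : C ⊗[K] M, Φ (TensorProduct.assoc K C C M
          ((Coalgebra.comul (R := K) (A := C)).rTensor M t)) =
        TensorProduct.lid K M ((f * g).unop.ofConv.rTensor M t) := by
      intro t
      induction t with
      | zero => simp
      | add x y hx hy => simp only [map_add, hx, hy]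
      | tmul x c => simp [Φ, LinearMap.convMul_apply]
    have h2 : ∀ t : C ⊗[K] M, Φ (LeftComodule.coact.lTensor C t) =
        TensorProduct.lid K M (f.unop.ofConv.rTensor M
          (LeftComodule.coact (TensorProduct.lid K M (g.unop.ofConv.rTensor M t)))) := by
      intro t
      induction t with
      | zero => simp
      | add x y hx hy => simp only [map_add, hx, hy]
      | tmul c x =>
        simp only [LinearMap.rTensor_tmul, LinearMap.lTensor_tmul, TensorProduct.lid_tmul, map_smul]
        generalize (LeftComodule.coact x : C ⊗[K] M) = s
        induction s with
        | zero => simp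
        | add x y hx hy => simp only [map_add, TensorProduct.tmul_add, smul_add, hx, hy]
        | tmul y d => simp [Φ, smul_smul]
    exact ((h1 _).symm.trans (congrArg Φ h)).trans (h2 _)
  smul_zero f := by
    change TensorProduct.lid K M (f.unop.ofConv.rTensor M (LeftComodule.coact (0 : M))) = 0
    simp
  smul_add f x y := by
    change TensorProduct.lid K M (f.unop.ofConv.rTensor M (LeftComodule.coact (x + y))) =
      TensorProduct.lid K M (f.unop.ofConv.rTensor M (LeftComodule.coact x)) +
        TensorProduct.lid K M (f.unop.ofConv.rTensor M (LeftComodule.coact y))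
    simp
  add_smul f g x := by
    change TensorProduct.lid K M ((f + g).unop.ofConv.rTensor M (LeftComodule.coact x)) =
      TensorProduct.lid K M (f.unop.ofConv.rTensor M (LeftComodule.coact x)) +
        TensorProduct.lid K M (g.unop.ofConv.rTensor M (LeftComodule.coact x))
    simp [LinearMap.rTensor_add]
  zero_smul x := by
    change TensorProduct.lid K M ((0 : (DualAlgebra K C)ᵐᵒᵖ).unop.ofConv.rTensor M
      (LeftComodule.coact x)) = 0
    simp

variable {M N}

/-- `φ` is a morphism of left comodules: `ρ(φ(m)) = m₋₁ ⊗ φ(m₀)`. -/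
def IsLeftHom (φ : M →ₗ[K] N) : Prop :=
  (LeftComodule.coact : N →ₗ[K] C ⊗[K] N) ∘ₗ φ =
    φ.lTensor C ∘ₗ (LeftComodule.coact : M →ₗ[K] C ⊗[K] M)

/-- `X` is a subcomodule of the left comodule `M`: `ρ(X) ⊆ C ⊗ X`. -/
def IsLeftSubcomodule (X : Submodule K M) : Prop :=
  X.map (LeftComodule.coact : M →ₗ[K] C ⊗[K] M) ≤ LinearMap.range (X.subtype.lTensor C)

variable (M)

/-- A simple left comodule: nonzero, with no subcomodules other than `0` and itself. -/
def IsSimpleLeftComodule : Prop :=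
  Nontrivial M ∧ ∀ X : Submodule K M, IsLeftSubcomodule K C X → X = ⊥ ∨ X = ⊤

end LeftDefs

end Defs

section Main

variable (K C : Type u) [Field K] [AddCommGroup C] [Module K C] [Coalgebra K C]

/-- `E` is an injective object of the category of left comodules: morphisms into `E` extend along
injective morphisms. -/
def IsInjectiveLeftComodule (E : Type u) [AddCommGroup E] [Module K E] [LeftComodule K C E] :
    Prop :=
  ∀ (X Y : Type u) [AddCommGroup X] [Module K X] [LeftComodule K C X]
    [AddCommGroup Y] [Module K Y] [LeftComodule K C Y]
    (i : X →ₗ[K] Y) (f : X →ₗ[K] E),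
    IsLeftHom K C i → Function.Injective i → IsLeftHom K C f →
      ∃ g : Y →ₗ[K] E, IsLeftHom K C g ∧ g ∘ₗ i = f

/-- `i : S → E` is an injective envelope of the left comodule `S`: `E` is injective and `i` is an
essential monomorphism of left comodules. -/
def IsInjectiveEnvelope {S E : Type u} [AddCommGroup S] [Module K S] [LeftComodule K C S]
    [AddCommGroup E] [Module K E] [LeftComodule K C E] (i : S →ₗ[K] E) : Prop :=
  IsInjectiveLeftComodule K C E ∧ IsLeftHom K C i ∧ Function.Injective i ∧
    ∀ X : Submodule K E, IsLeftSubcomodule K C X → X ≠ ⊥ → X ⊓ LinearMap.range i ≠ ⊥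

/-- The injective envelope of every simple left comodule has finite Loewy length (as a right
`C^*`-module). -/
def SimpleEnvelopesHaveFiniteLoewyLength : Prop :=
  ∀ (S E : Type u) [AddCommGroup S] [Module K S] [LeftComodule K C S]
    [AddCommGroup E] [Module K E] [LeftComodule K C E] (i : S →ₗ[K] E),
    IsSimpleLeftComodule K C S → IsInjectiveEnvelope K C i →
      HasFiniteLoewyLength (DualAlgebra K C)ᵐᵒᵖ E

/-- `P` is a projective object of the category of right comodules: morphisms out of `P` lift along
surjective morphisms. -/
def IsProjectiveRightComodule (P : Type u) [AddCommGroup P] [Module K P] [RightComodule K C P] :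
    Prop :=
  ∀ (X Y : Type u) [AddCommGroup X] [Module K X] [RightComodule K C X]
    [AddCommGroup Y] [Module K Y] [RightComodule K C Y]
    (p : X →ₗ[K] Y) (f : P →ₗ[K] Y),
    IsRightHom K C p → Function.Surjective p → IsRightHom K C f →
      ∃ g : P →ₗ[K] X, IsRightHom K C g ∧ p ∘ₗ g = f

/-- `p : P → M` is a projective cover of the right comodule `M`: `P` is projective and `p` is an
epimorphism of right comodules with superfluous kernel. -/
def IsProjectiveCover {P M : Type u} [AddCommGroup P] [Module K P] [RightComodule K C P]
    [AddCommGroup M] [Module K M] [RightComodule K C M] (p : P →ₗ[K] M) : Prop :=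
  IsProjectiveRightComodule K C P ∧ IsRightHom K C p ∧ Function.Surjective p ∧
    ∀ X : Submodule K P, IsRightSubcomodule K C X → X ⊔ LinearMap.ker p = ⊤ → X = ⊤

/-- `C` is right semiperfect: every finite dimensional right comodule has a projective cover in
the category of right comodules. -/
def IsRightSemiperfect : Prop :=
  ∀ (M : Type u) [AddCommGroup M] [Module K M] [RightComodule K C M], Module.Finite K M →
    ∃ (P : Type u) (_ : AddCommGroup P) (_ : Module K P) (_ : RightComodule K C P)
      (p : P →ₗ[K] M), IsProjectiveCover K C p

/-- `C` is right quasi-co-Frobenius: `C` embeds, as a right `C^*`-module, in a direct sum of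
copies of `C^*`. -/
def IsRightQcF : Prop :=
  ∃ (ι : Type u) (j : C →ₗ[(DualAlgebra K C)ᵐᵒᵖ] (ι →₀ DualAlgebra K C)), Function.Injective j

/-- `C` generates its right comodules: every right comodule `M` is a quotient of a direct sum of
copies of the right comodule `C`, that is, `M` is the sum of the images of a family of morphisms
`C → M`. -/
def RightGeneratingCondition : Prop :=
  ∀ (M : Type u) [AddCommGroup M] [Module K M] [RightComodule K C M],
    ∃ (ι : Type u) (φ : ι → C →ₗ[K] M),
      (∀ i, IsRightHom K C (φ i)) ∧ ⨆ i, LinearMap.range (φ i) = ⊤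

/-- The coradical filtration `Cₙ = Lₙ₊₁(C)`, with `C` regarded as a right comodule over itself
(a left `C^*`-module). -/
noncomputable def coradicalFiltration (n : ℕ) : Submodule (DualAlgebra K C) C :=
  loewySeries (DualAlgebra K C) C (n + 1)

end Main

end ComoduleTheory

/-! Right modules over the dual algebra `A = C^*` are modules over `Aᵐᵒᵖ`, and comodules are the
same as rational modules: those in which every element is annihilated by the functionals vanishing
on some finite subset of `C`. This dictionary (`isRational_left_exists_comodule`, `isRightHom_iff`,
`isRightSubcomodule_iff` and their mirror images) turns everything into module theory. A simple
right submodule `S` of `C` is essential in a retract `E` of `C` (`exists_retract_of_isAtom`), since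
`C` is injective among rational modules; this `E` is its injective hull. All conditions are compared
with one finiteness statement, `HullsAreFinite`: every such `E` is finite dimensional.

The generating condition enters in `RightGeneratingCondition.finite_of_pow_smul_eq_zero`, which says
that `E` is finite dimensional as soon as a power of the annihilator `J` of the coradical kills it.
This yields finiteness both from the Loewy lengths of the envelopes and from a finite coradical
filtration. The point is that if `J^(k+1)` kills `E` then `J^k` kills every proper submodule of
every finite dimensional submodule `N` of `E` (`RightGeneratingCondition.smul_eq_zero_of_lt`); so if
`k` is minimal, an element of `E` not killed by `J^k` generates `E`. To see this, note that `N^*` is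
generated by any functional not vanishing on `S`, and that by the generating condition some morphism
`φ` from `C` to `N^*` has such a generator in its image. Fitting's lemma in a finite dimensional
subcoalgebra (`exists_isEssentialSimple_of_sup`) makes `φ` surjective already on a submodule `X`
with an essential simple submodule `T`. If `X' ≤ X` is minimal with `φ(X') = N^*`, then `N` is
essential in the dual of `X'`, which therefore embeds in `E`; so `J^(k+1)` kills `X'`, and `J^k X'`
lies in the coradical, hence in `T`. For a proper submodule `B` of `N` the functionals vanishing on
`B` form a nonzero submodule of `N^*`, whose preimage in `X` contains `T`. Hence the functionals in
`J^k N^* = φ(J^k X')` vanish on `B`, which means that `J^k` kills `B`.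

Suppose that the hulls are finite dimensional. A hull embeds in `A`: dualize a morphism from `C`
whose image contains a generator of `E^*` (`RightGeneratingCondition.exists_embedding`). A maximal
independent family of hulls has sum `C`, as finite sums of hulls are again retracts; so `C` embeds
in a direct sum of copies of `A` (`RightGeneratingCondition.isRightQcF`). The duals of the hulls are
direct summands of `A`, hence projective, and every nonzero rational module receives a nonzero
morphism from one of them (`IsRational.exists_hull_dual_hom`), so every finite dimensional comodule
is a quotient of a finite dimensional projective one, and Fitting's lemma cuts it down to a
projective cover (`HullsAreFinite.isRightSemiperfect`).

Conversely, let `S` be an essential simple subcomodule of a left comodule `E`. The dual of a finite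
dimensional `N` with `S ≤ N ≤ E` is generated by any functional not vanishing on `S`
(`IsEssentialSimple.exists_smul_eq`). If `C` is semiperfect, the projective cover of `S^*` therefore
maps onto `N^*`, which bounds the dimension of `N`. If `C` is quasi-co-Frobenius, a matrix
coefficient map `E → C` followed by a coordinate `C → A` gives a pairing through which a cyclic
submodule of `C` maps onto `E^*`. In both cases `E` is finite dimensional. -/

namespace ComoduleTheory

/-! ### Rational modules -/

section Rational

/-- A ring `R` acting on the coalgebra `C` and identified by `eval` with the linear dual of `C`, in
such a way that the action on `C` is adjoint to the multiplication of `R`. The two examples are the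
dual algebra `C^*`, acting on `C` from the left, and its opposite ring, which encodes the right
action; this class lets the one-sided theory be developed for both at once. -/
class DualAction (K C : outParam (Type*)) (R : Type*) [Field K] [AddCommGroup C] [Module K C]
    [Ring R] [Algebra K R] [Module R C] where
  /-- the functional on `C` given by an element of `R` -/
  eval : R ≃ₗ[K] (C →ₗ[K] K)
  eval_smul : ∀ (s r : R) (c : C), eval s (r • c) = eval (s * r) c
  /-- the module `C` is rational, in the sense of `IsRational` -/
  exists_finset : ∀ c : C, ∃ F : Finset C, ∀ r : R, (∀ d ∈ F, eval r d = 0) → r • c = 0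

open DualAction

variable {K C R : Type*} [Field K] [AddCommGroup C] [Module K C] [Ring R] [Algebra K R]
  [Module R C] [DualAction K C R]

/-- An `R`-module `M` is rational if every `m : M` is annihilated by all elements of `R` whose
functionals vanish on some finite subset of `C`. -/
def IsRational (R M : Type*) {K C : Type*} [Field K] [AddCommGroup C] [Module K C] [Ring R]
    [Algebra K R] [Module R C] [DualAction K C R] [AddCommGroup M] [Module R M] : Prop :=
  ∀ m : M, ∃ F : Finset C, ∀ r : R, (∀ c ∈ F, eval r c = 0) → r • m = 0

theorem isRational_self : IsRational R C :=
  DualAction.exists_finset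

variable {M N : Type*} [AddCommGroup M] [Module R M] [AddCommGroup N] [Module R N]

theorem eval_ext {c d : C} (h : ∀ r : R, eval r c = eval r d) : c = d := by
  rw [← sub_eq_zero, ← Module.forall_dual_apply_eq_zero_iff K]
  intro φ
  simpa [sub_eq_zero] using h (eval.symm φ)

theorem IsRational.of_injective (hN : IsRational R N) (f : M →ₗ[R] N)
    (hf : Function.Injective f) : IsRational R M := by
  intro m
  obtain ⟨F, hF⟩ := hN (f m)
  exact ⟨F, fun r hr => hf (by simpa using hF r hr)⟩

theorem IsRational.of_surjective (hM : IsRational R M) (f : M →ₗ[R] N)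
    (hf : Function.Surjective f) : IsRational R N := by
  intro n
  obtain ⟨m, rfl⟩ := hf n
  obtain ⟨F, hF⟩ := hM m
  exact ⟨F, fun r hr => by rw [← map_smul, hF r hr, map_zero]⟩

theorem IsRational.submodule (hM : IsRational R M) (X : Submodule R M) : IsRational R X :=
  hM.of_injective X.subtype X.injective_subtype

theorem IsRational.quotient (hM : IsRational R M) (X : Submodule R M) : IsRational R (M ⧸ X) :=
  hM.of_surjective X.mkQ X.mkQ_surjective

theorem IsRational.prod (hM : IsRational R M) (hN : IsRational R N) : IsRational R (M × N) := by
  classical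
  rintro ⟨m, n⟩
  obtain ⟨F, hF⟩ := hM m
  obtain ⟨G, hG⟩ := hN n
  refine ⟨F ∪ G, fun r hr => ?_⟩
  rw [Prod.smul_mk, hF r fun c hc => hr c (Finset.mem_union_left _ hc),
    hG r fun c hc => hr c (Finset.mem_union_right _ hc), Prod.mk_zero_zero]

instance DualAction.isScalarTower : IsScalarTower K R C where
  smul_assoc k r c := eval_ext (R := R) fun s => by
    rw [eval_smul, mul_smul_comm, map_smul, map_smul, eval_smul, LinearMap.smul_apply]

variable [Module K M] [IsScalarTower K R M]

theorem finite_sup {K R M : Type*} [Field K] [Ring R] [Algebra K R] [AddCommGroup M] [Module R M]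
    [Module K M] [IsScalarTower K R M] {X Y : Submodule R M} (hX : Module.Finite K X)
    (hY : Module.Finite K Y) : Module.Finite K ↥(X ⊔ Y) := by
  have hX' : Module.Finite K (X.restrictScalars K) := hX
  have hY' : Module.Finite K (Y.restrictScalars K) := hY
  have h := Submodule.finite_sup (X.restrictScalars K) (Y.restrictScalars K)
  rw [← Submodule.restrictScalars_sup] at h
  exact h

/-- The action on `m` has the form `s • m = ∑ s(cᵢ) mᵢ`, where moreover each `mᵢ` is a multiple
of `m`. -/
theorem IsRational.exists_expansion (hM : IsRational R M) (m : M) :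
    ∃ (n : ℕ) (c : Fin n → C) (r : Fin n → R),
      ∀ s : R, s • m = ∑ i, eval s (c i) • r i • m := by
  classical
  obtain ⟨F, hF⟩ := hM m
  let V : Submodule K C := Submodule.span K (F : Set C)
  let b := Module.finBasis K V
  have hext : ∀ i, ∃ g : C →ₗ[K] K, g ∘ₗ V.subtype = b.coord i := fun i =>
    LinearMap.exists_extend _
  choose g hg using hext
  refine ⟨_, fun i => (b i : C), fun i => eval.symm (g i), fun s => ?_⟩
  have h0 : (s - ∑ i, eval s (b i : C) • (eval.symm (g i) : R)) • m = 0 := by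
    refine hF _ fun c hc => ?_
    have hc' : c ∈ V := Submodule.subset_span hc
    have h1 : c = ∑ i, g i c • (b i : C) := by
      have h2 := congrArg V.subtype (b.sum_repr ⟨c, hc'⟩)
      have h3 : ∀ i, g i c = b.repr ⟨c, hc'⟩ i := fun i =>
        LinearMap.congr_fun (hg i) ⟨c, hc'⟩
      simp only [h3]
      rw [map_sum] at h2
      exact h2.symm
    simp only [map_sub, map_sum, map_smul, LinearEquiv.apply_symm_apply, LinearMap.sub_apply,
      LinearMap.sum_apply, LinearMap.smul_apply, smul_eq_mul]
    conv_lhs => rw [h1]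
    conv_lhs =>
      enter [1]
      rw [map_sum]
    rw [← h1, sub_eq_zero]
    exact Finset.sum_congr rfl fun i _ => by rw [map_smul, smul_eq_mul, mul_comm]
  rw [sub_smul, Finset.sum_smul, sub_eq_zero] at h0
  simpa [smul_assoc] using h0

/-- The finiteness theorem for rational modules: cyclic submodules are finite dimensional. -/
theorem IsRational.finite_span_singleton (hM : IsRational R M) (m : M) :
    Module.Finite K (Submodule.span R {m}) := by
  obtain ⟨n, c, r, h⟩ := hM.exists_expansion m
  let V : Submodule K M := Submodule.span K (Set.range fun i => r i • m)
  have hV : (Submodule.span R {m}).restrictScalars K ≤ V := by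
    intro x hx
    obtain ⟨s, rfl⟩ := Submodule.mem_span_singleton.1 hx
    rw [h s]
    exact Submodule.sum_mem _ fun i _ => V.smul_mem _ (Submodule.subset_span ⟨i, rfl⟩)
  have : Module.Finite K V := Module.Finite.span_of_finite K (Set.finite_range _)
  exact Submodule.finiteDimensional_of_le hV

theorem IsRational.finite_of_fg (hM : IsRational R M) {X : Submodule R M} (hX : X.FG) :
    Module.Finite K X := by
  classical
  obtain ⟨s, rfl⟩ := hX
  induction s using Finset.induction with
  | empty =>
    rw [Finset.coe_empty, Submodule.span_empty]
    infer_instance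
  | insert a s _ ih =>
    rw [Finset.coe_insert, Submodule.span_insert]
    exact finite_sup (hM.finite_span_singleton a) ih

/-- The matrix coefficients of `u`, as a map into `C`: the functional `r ↦ u (r • m)` on the dual
of `C` is evaluation at an element of `C` because `M` is rational. -/
theorem IsRational.exists_coefficient_map (hM : IsRational R M) (u : M →ₗ[K] K) :
    ∃ θ : M →ₗ[R] C, ∀ (r : R) (m : M), eval r (θ m) = u (r • m) := by
  have h : ∀ m : M, ∃ c : C, ∀ r : R, eval r c = u (r • m) := by
    intro m
    obtain ⟨n, c, r, h⟩ := hM.exists_expansion m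
    refine ⟨∑ i, u (r i • m) • c i, fun s => ?_⟩
    rw [h s, map_sum, map_sum]
    exact Finset.sum_congr rfl fun i _ => by simp [mul_comm]
  choose θ hθ using h
  refine ⟨⟨⟨θ, fun x y => eval_ext (R := R) fun r => ?_⟩, fun s x => eval_ext (R := R) fun r => ?_⟩,
    fun r m => hθ m r⟩
  · rw [map_add, hθ, hθ, hθ, smul_add, map_add]
  · rw [RingHom.id_apply, eval_smul, hθ, hθ, mul_smul]

/-- If no nonzero vector has all its matrix coefficients with respect to `u` equal to zero, then
every functional is obtained from `u` by the action. -/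
theorem IsRational.exists_functional_eq (hM : IsRational R M) {u : M →ₗ[K] K}
    (hu : ∀ m, (∀ r : R, u (r • m) = 0) → m = 0) (v : M →ₗ[K] K) :
    ∃ r : R, ∀ m, v m = u (r • m) := by
  obtain ⟨θ, hθ⟩ := hM.exists_coefficient_map u
  have hinj : Function.Injective θ := by
    rw [← LinearMap.ker_eq_bot, LinearMap.ker_eq_bot']
    intro m hm
    exact hu m fun r => by rw [← hθ, hm, map_zero]
  let η : M →ₗ[K] C := θ.restrictScalars K
  obtain ⟨l, hl⟩ := η.exists_leftInverse_of_injective (LinearMap.ker_eq_bot.2 hinj)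
  refine ⟨eval.symm (v ∘ₗ l), fun m => ?_⟩
  rw [← hθ, LinearEquiv.apply_symm_apply]
  exact congrArg v (LinearMap.congr_fun hl m).symm

/-- Elements of `M ⊗ C` are detected by applying functionals to the factor `C`. -/
theorem tensor_eq_zero_of_slices {M : Type*} [AddCommGroup M] [Module K M] {t : M ⊗[K] C}
    (h : ∀ φ : C →ₗ[K] K, TensorProduct.rid K M (φ.lTensor M t) = 0) : t = 0 := by
  classical
  let b := Module.Free.chooseBasis K C
  apply (TensorProduct.equivFinsuppOfBasisRight b).injective
  ext i
  simpa [TensorProduct.equivFinsuppOfBasisRight_apply] using h (b.coord i)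

theorem tensor_ext_of_slices {M : Type*} [AddCommGroup M] [Module K M] {t t' : M ⊗[K] C}
    (h : ∀ φ : C →ₗ[K] K, TensorProduct.rid K M (φ.lTensor M t) =
      TensorProduct.rid K M (φ.lTensor M t')) : t = t' := by
  rw [← sub_eq_zero]
  exact tensor_eq_zero_of_slices fun φ => by rw [map_sub, map_sub, h, sub_self]

/-- A rational module has a coaction map inducing the action. -/
theorem IsRational.exists_coaction (hM : IsRational R M) :
    ∃ ρ : M →ₗ[K] M ⊗[K] C, ∀ (r : R) (m : M),
      TensorProduct.rid K M ((eval r).lTensor M (ρ m)) = r • m := by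
  have h : ∀ m : M, ∃ t : M ⊗[K] C, ∀ φ : C →ₗ[K] K,
      TensorProduct.rid K M (φ.lTensor M t) = (eval.symm φ : R) • m := by
    intro m
    obtain ⟨n, c, r, h⟩ := hM.exists_expansion m
    refine ⟨∑ i, (r i • m) ⊗ₜ c i, fun φ => ?_⟩
    simp [h (eval.symm φ)]
  choose ρ hρ using h
  refine ⟨⟨⟨ρ, fun x y => tensor_ext_of_slices fun φ => ?_⟩,
    fun s x => tensor_ext_of_slices fun φ => ?_⟩, fun r m => ?_⟩
  · rw [map_add, map_add, hρ, hρ, hρ, smul_add]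
  · have : SMulCommClass K R M := IsScalarTower.to_smulCommClass
    rw [RingHom.id_apply, map_smul, map_smul, hρ, hρ, smul_comm]
  · exact (hρ m (eval r)).trans (by rw [LinearEquiv.symm_apply_apply])

/-- A submodule `N` such that every finite dimensional submodule containing `N` equals `N` is
everything. -/
theorem IsRational.eq_top_of_forall_finite (hM : IsRational R M) {N : Submodule R M}
    [Module.Finite K N]
    (h : ∀ N' : Submodule R M, Module.Finite K N' → N ≤ N' → N' = N) : N = ⊤ := by
  rw [Submodule.eq_top_iff']
  intro x
  have h1 := hM.finite_span_singleton (K := K) x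
  have h2 : Module.Finite K ↥(N ⊔ Submodule.span R {x}) :=
    finite_sup inferInstance h1
  rw [← h _ h2 le_sup_left]
  exact Submodule.mem_sup_right (Submodule.mem_span_singleton_self x)

end Rational

/-! ### Comodules as rational modules -/

section Sides

open DualAction

variable {K C : Type*} [Field K] [AddCommGroup C] [Module K C]

theorem tensor_exists_finset {M : Type*} [AddCommGroup M] [Module K M] (t : M ⊗[K] C) :
    ∃ F : Finset C, ∀ φ : C →ₗ[K] K, (∀ c ∈ F, φ c = 0) → φ.lTensor M t = 0 := by
  classical
  induction t with
  | zero => exact ⟨∅, fun φ _ => map_zero _⟩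
  | tmul m c => exact ⟨{c}, fun φ h => by simp [h c (Finset.mem_singleton_self c)]⟩
  | add x y hx hy =>
    obtain ⟨F, hF⟩ := hx
    obtain ⟨G, hG⟩ := hy
    refine ⟨F ∪ G, fun φ h => ?_⟩
    rw [map_add, hF φ fun c hc => h c (Finset.mem_union_left _ hc),
      hG φ fun c hc => h c (Finset.mem_union_right _ hc), add_zero]

theorem lid_rTensor_eq_rid_lTensor {M : Type*} [AddCommGroup M] [Module K M] (φ : C →ₗ[K] K)
    (t : C ⊗[K] M) : TensorProduct.lid K M (φ.rTensor M t) =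
      TensorProduct.rid K M (φ.lTensor M (TensorProduct.comm K C M t)) := by
  induction t with
  | zero => simp
  | tmul c m => simp
  | add x y hx hy => simp only [map_add, hx, hy]

theorem slice_rTensor {M N : Type*} [AddCommGroup M] [Module K M] [AddCommGroup N] [Module K N]
    (φ : C →ₗ[K] K) (ρ : M →ₗ[K] N) (t : M ⊗[K] C) :
    TensorProduct.rid K N (φ.lTensor N (ρ.rTensor C t)) =
      ρ (TensorProduct.rid K M (φ.lTensor M t)) := by
  induction t with
  | zero => simp
  | tmul c m => simp
  | add x y hx hy => simp only [map_add, hx, hy]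

theorem slice_lTensor {M N : Type*} [AddCommGroup M] [Module K M] [AddCommGroup N] [Module K N]
    (φ : C →ₗ[K] K) (ρ : M →ₗ[K] N) (t : C ⊗[K] M) :
    TensorProduct.lid K N (φ.rTensor N (ρ.lTensor C t)) =
      ρ (TensorProduct.lid K M (φ.rTensor M t)) := by
  induction t with
  | zero => simp
  | tmul c m => simp
  | add x y hx hy => simp only [map_add, hx, hy]

theorem left_tensor_ext_of_slices {M : Type*} [AddCommGroup M] [Module K M] {t t' : C ⊗[K] M}
    (h : ∀ φ : C →ₗ[K] K, TensorProduct.lid K M (φ.rTensor M t) =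
      TensorProduct.lid K M (φ.rTensor M t')) : t = t' := by
  apply (TensorProduct.comm K C M).injective
  refine tensor_ext_of_slices fun φ => ?_
  rw [← lid_rTensor_eq_rid_lTensor, ← lid_rTensor_eq_rid_lTensor, h]

variable [Coalgebra K C]

theorem rightComodule_smul_def {M : Type*} [AddCommGroup M] [Module K M] [RightComodule K C M]
    (f : DualAlgebra K C) (m : M) :
    f • m = TensorProduct.rid K M (f.ofConv.lTensor M (RightComodule.coact m)) := rfl

theorem leftComodule_smul_def {M : Type*} [AddCommGroup M] [Module K M] [LeftComodule K C M]
    (f : (DualAlgebra K C)ᵐᵒᵖ) (m : M) :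
    f • m = TensorProduct.lid K M (f.unop.ofConv.rTensor M (LeftComodule.coact m)) := rfl

instance RightComodule.isScalarTower {M : Type*} [AddCommGroup M] [Module K M]
    [RightComodule K C M] : IsScalarTower K (DualAlgebra K C) M where
  smul_assoc k f m := by
    rw [rightComodule_smul_def, rightComodule_smul_def, WithConv.ofConv_smul,
      LinearMap.lTensor_smul, LinearMap.smul_apply, map_smul]

instance LeftComodule.isScalarTower {M : Type*} [AddCommGroup M] [Module K M]
    [LeftComodule K C M] : IsScalarTower K (DualAlgebra K C)ᵐᵒᵖ M where
  smul_assoc k f m := by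
    rw [leftComodule_smul_def, leftComodule_smul_def, MulOpposite.unop_smul, WithConv.ofConv_smul,
      LinearMap.rTensor_smul, LinearMap.smul_apply, map_smul]

/-- The left action of `C^*` on `C`, namely `f • c = f(c₂) c₁`. -/
instance leftDualAction : DualAction K C (DualAlgebra K C) where
  eval := WithConv.linearEquiv K (C →ₗ[K] K)
  eval_smul s r c := by
    rw [rightComodule_smul_def]
    change s.ofConv _ = (s * r).ofConv c
    rw [LinearMap.convMul_apply]
    change s.ofConv (TensorProduct.rid K C (r.ofConv.lTensor C (Coalgebra.comul c))) = _
    generalize (Coalgebra.comul c : C ⊗[K] C) = t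
    induction t with
    | zero => simp
    | tmul x y => simp [mul_comm]
    | add x y hx hy => simp only [map_add, hx, hy]
  exists_finset c := by
    obtain ⟨F, hF⟩ := tensor_exists_finset (RightComodule.coact (K := K) (C := C) c)
    refine ⟨F, fun r hr => ?_⟩
    rw [rightComodule_smul_def, hF r.ofConv hr, map_zero]

/-- The right action of `C^*` on `C`, namely `c • f = f(c₁) c₂`. -/
noncomputable instance rightDualAction : DualAction K C (DualAlgebra K C)ᵐᵒᵖ where
  eval := (MulOpposite.opLinearEquiv K).symm ≪≫ₗ WithConv.linearEquiv K (C →ₗ[K] K)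
  eval_smul s r c := by
    rw [leftComodule_smul_def]
    change s.unop.ofConv _ = (r.unop * s.unop).ofConv c
    rw [LinearMap.convMul_apply]
    change s.unop.ofConv (TensorProduct.lid K C (r.unop.ofConv.rTensor C (Coalgebra.comul c))) = _
    generalize (Coalgebra.comul c : C ⊗[K] C) = t
    induction t with
    | zero => simp
    | tmul x y => simp
    | add x y hx hy => simp only [map_add, hx, hy]
  exists_finset c := by
    obtain ⟨F, hF⟩ := tensor_exists_finset
      (TensorProduct.comm K C C (LeftComodule.coact (K := K) (C := C) c))
    refine ⟨F, fun r hr => ?_⟩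
    rw [leftComodule_smul_def, lid_rTensor_eq_rid_lTensor, hF r.unop.ofConv hr, map_zero]

theorem isRational_of_rightComodule (M : Type*) [AddCommGroup M] [Module K M]
    [RightComodule K C M] : IsRational (DualAlgebra K C) M := by
  intro m
  obtain ⟨F, hF⟩ := tensor_exists_finset (RightComodule.coact (K := K) (C := C) m)
  refine ⟨F, fun r hr => ?_⟩
  rw [rightComodule_smul_def, hF r.ofConv hr, map_zero]

theorem isRational_of_leftComodule (M : Type*) [AddCommGroup M] [Module K M]
    [LeftComodule K C M] : IsRational (DualAlgebra K C)ᵐᵒᵖ M := by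
  intro m
  obtain ⟨F, hF⟩ := tensor_exists_finset
    (TensorProduct.comm K C M (LeftComodule.coact (K := K) (C := C) m))
  refine ⟨F, fun r hr => ?_⟩
  rw [leftComodule_smul_def, lid_rTensor_eq_rid_lTensor, hF r.unop.ofConv hr, map_zero]

/-- The left and right actions of the dual algebra on `C` commute. -/
theorem smul_op_smul_comm (f : DualAlgebra K C) (g : (DualAlgebra K C)ᵐᵒᵖ) (c : C) :
    f • g • c = g • f • c := by
  refine eval_ext (R := DualAlgebra K C) fun h => ?_
  have e1 : ∀ (a : DualAlgebra K C) (b : (DualAlgebra K C)ᵐᵒᵖ) (d : C),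
      eval a (b • d) = eval (b.unop * a) d := fun a b d =>
    eval_smul (MulOpposite.op a) b d
  rw [eval_smul, e1, e1, eval_smul, mul_assoc]

/-- A shortcut instance: the additive group of a submodule, found without unifying the semiring
structures of the dual algebra. -/
noncomputable instance (priority := 10000) leftSubmoduleAddCommGroup {M : Type*} [AddCommGroup M]
    [Module (DualAlgebra K C) M] (N : Submodule (DualAlgebra K C) M) : AddCommGroup N :=
  N.addCommGroup

/-- A shortcut instance: the additive group of a submodule, found without unifying the semiring
structures of the opposite of the dual algebra. -/
noncomputable instance (priority := 10000) rightSubmoduleAddCommGroup {M : Type*} [AddCommGroup M]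
    [Module (DualAlgebra K C)ᵐᵒᵖ M] (N : Submodule (DualAlgebra K C)ᵐᵒᵖ M) : AddCommGroup N :=
  N.addCommGroup

/-- Every rational left `C^*`-module comes from a right comodule. The equality of module structures
allows the given structure to be replaced by the comodule structure. -/
theorem isRational_left_exists_comodule {M : Type*} [AddCommGroup M] [Module K M]
    [inst : Module (DualAlgebra K C) M] [IsScalarTower K (DualAlgebra K C) M]
    (hM : IsRational (DualAlgebra K C) M) :
    ∃ h : RightComodule K C M, @RightComodule.toModule K C _ _ _ _ M _ _ h = inst := by
  obtain ⟨ρ, hρ⟩ := hM.exists_coaction (K := K)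
  have hρ' : ∀ (φ : C →ₗ[K] K) (m : M),
      TensorProduct.rid K M (φ.lTensor M (ρ m)) = WithConv.toConv φ • m :=
    fun φ m => hρ (WithConv.toConv φ) m
  have hsm : SMulCommClass K (DualAlgebra K C) M := IsScalarTower.to_smulCommClass
  let h : RightComodule K C M :=
    { coact := ρ
      coassoc := by
        ext m
        apply (TensorProduct.assoc K M C C).symm.injective
        refine tensor_ext_of_slices fun ψ => tensor_ext_of_slices fun φ => ?_
        have h2 : ∀ t : M ⊗[K] C, TensorProduct.rid K M (φ.lTensor M (TensorProduct.rid K (M ⊗[K] C)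
            (ψ.lTensor (M ⊗[K] C) ((TensorProduct.assoc K M C C).symm
              ((Coalgebra.comul (R := K) (A := C)).lTensor M t))))) =
            TensorProduct.rid K M ((WithConv.toConv φ * WithConv.toConv ψ :
              DualAlgebra K C).ofConv.lTensor M t) := by
          intro t
          induction t with
          | zero => simp
          | add x y hx hy => simp only [map_add, hx, hy]
          | tmul x c =>
            simp only [LinearMap.lTensor_tmul, TensorProduct.rid_tmul, LinearMap.convMul_apply]
            generalize (Coalgebra.comul c : C ⊗[K] C) = s
            induction s with
            | zero => simp
            | add x y hx hy => simp only [map_add, TensorProduct.tmul_add, add_smul, hx, hy]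
            | tmul y d => simp [smul_smul, mul_comm]
        simp only [LinearMap.comp_apply, LinearEquiv.coe_coe, LinearEquiv.symm_apply_apply]
        rw [h2, slice_rTensor, hρ', hρ', ← mul_smul]
        exact (hρ _ m).symm
      counit_coact := by
        ext m
        apply (TensorProduct.rid K M).injective
        rw [LinearMap.comp_apply, hρ']
        have : (WithConv.toConv (Coalgebra.counit (R := K) (A := C)) : DualAlgebra K C) = 1 := by
          ext c; simp
        rw [this]
        simp }
  exact ⟨h, Module.ext' _ _ fun f m => hρ f m⟩

/-- Every rational right `C^*`-module comes from a left comodule. -/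
theorem isRational_right_exists_comodule {M : Type*} [AddCommGroup M] [Module K M]
    [inst : Module (DualAlgebra K C)ᵐᵒᵖ M] [IsScalarTower K (DualAlgebra K C)ᵐᵒᵖ M]
    (hM : IsRational (DualAlgebra K C)ᵐᵒᵖ M) :
    ∃ h : LeftComodule K C M, @LeftComodule.toModule K C _ _ _ _ M _ _ h = inst := by
  obtain ⟨ρ₀, hρ₀⟩ := hM.exists_coaction (K := K)
  let ρ : M →ₗ[K] C ⊗[K] M := (TensorProduct.comm K C M).symm.toLinearMap ∘ₗ ρ₀
  have hρ : ∀ (f : (DualAlgebra K C)ᵐᵒᵖ) (m : M),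
      TensorProduct.lid K M (f.unop.ofConv.rTensor M (ρ m)) = f • m := fun f m => by
    rw [lid_rTensor_eq_rid_lTensor]
    simp only [ρ, LinearMap.comp_apply, LinearEquiv.coe_coe, LinearEquiv.apply_symm_apply]
    exact hρ₀ f m
  have hρ' : ∀ (φ : C →ₗ[K] K) (m : M), TensorProduct.lid K M (φ.rTensor M (ρ m)) =
      MulOpposite.op (WithConv.toConv φ : DualAlgebra K C) • m :=
    fun φ m => hρ (MulOpposite.op (WithConv.toConv φ)) m
  let h : LeftComodule K C M :=
    { coact := ρ
      coassoc := by
        ext m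
        refine left_tensor_ext_of_slices fun φ => left_tensor_ext_of_slices fun ψ => ?_
        have h2 : ∀ t : C ⊗[K] M, TensorProduct.lid K M (ψ.rTensor M (TensorProduct.lid K (C ⊗[K] M)
            (φ.rTensor (C ⊗[K] M) (TensorProduct.assoc K C C M
              ((Coalgebra.comul (R := K) (A := C)).rTensor M t))))) =
            TensorProduct.lid K M ((WithConv.toConv φ * WithConv.toConv ψ :
              DualAlgebra K C).ofConv.rTensor M t) := by
          intro t
          induction t with
          | zero => simp
          | add x y hx hy => simp only [map_add, hx, hy]
          | tmul c x =>
            simp only [LinearMap.rTensor_tmul, TensorProduct.lid_tmul, LinearMap.convMul_apply]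
            generalize (Coalgebra.comul c : C ⊗[K] C) = s
            induction s with
            | zero => simp
            | add x y hx hy => simp only [map_add, TensorProduct.add_tmul, add_smul, hx, hy]
            | tmul y d => simp [smul_smul]
        simp only [LinearMap.comp_apply, LinearEquiv.coe_coe]
        rw [h2, slice_lTensor, hρ' φ m, hρ' ψ, ← mul_smul, ← MulOpposite.op_mul]
        exact hρ (MulOpposite.op _) m
      counit_coact := by
        ext m
        apply (TensorProduct.lid K M).injective
        rw [LinearMap.comp_apply, hρ']
        have : (WithConv.toConv (Coalgebra.counit (R := K) (A := C)) : DualAlgebra K C) = 1 := by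
          ext c; simp
        rw [this]
        simp }
  exact ⟨h, Module.ext' _ _ fun f m => hρ f m⟩

theorem isRightHom_iff {M N : Type*} [AddCommGroup M] [Module K M] [RightComodule K C M]
    [AddCommGroup N] [Module K N] [RightComodule K C N] (φ : M →ₗ[K] N) :
    IsRightHom K C φ ↔ ∀ (f : DualAlgebra K C) (m : M), φ (f • m) = f • φ m := by
  constructor
  · intro h f m
    rw [rightComodule_smul_def, rightComodule_smul_def, ← slice_rTensor]
    exact congrArg (fun t => TensorProduct.rid K N (f.ofConv.lTensor N t))
      (LinearMap.congr_fun h m).symm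
  · intro h
    refine LinearMap.ext fun m => tensor_ext_of_slices fun f => ?_
    rw [LinearMap.comp_apply, LinearMap.comp_apply, slice_rTensor]
    exact (h (WithConv.toConv f) m).symm

theorem isLeftHom_iff {M N : Type*} [AddCommGroup M] [Module K M] [LeftComodule K C M]
    [AddCommGroup N] [Module K N] [LeftComodule K C N] (φ : M →ₗ[K] N) :
    IsLeftHom K C φ ↔ ∀ (f : (DualAlgebra K C)ᵐᵒᵖ) (m : M), φ (f • m) = f • φ m := by
  constructor
  · intro h f m
    rw [leftComodule_smul_def, leftComodule_smul_def, ← slice_lTensor]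
    exact congrArg (fun t => TensorProduct.lid K N (f.unop.ofConv.rTensor N t))
      (LinearMap.congr_fun h m).symm
  · intro h
    refine LinearMap.ext fun m => left_tensor_ext_of_slices fun f => ?_
    rw [LinearMap.comp_apply, LinearMap.comp_apply, slice_lTensor]
    exact (h (MulOpposite.op (WithConv.toConv f)) m).symm

theorem isRightSubcomodule_iff {M : Type*} [AddCommGroup M] [Module K M] [RightComodule K C M]
    (X : Submodule K M) :
    IsRightSubcomodule K C X ↔ ∀ (f : DualAlgebra K C), ∀ m ∈ X, f • m ∈ X := by
  constructor
  · intro h f m hm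
    obtain ⟨t, ht⟩ := h (Submodule.mem_map_of_mem hm)
    rw [rightComodule_smul_def, ← ht, slice_rTensor]
    exact Submodule.coe_mem _
  · rintro h _ ⟨m, hm, rfl⟩
    rw [← LinearMap.exact_iff.1 (rTensor_exact C (LinearMap.exact_subtype_mkQ X) X.mkQ_surjective),
      LinearMap.mem_ker]
    refine tensor_eq_zero_of_slices fun f => ?_
    rw [slice_rTensor]
    exact (Submodule.Quotient.mk_eq_zero X).2 (h (WithConv.toConv f) m hm)

theorem isLeftSubcomodule_iff {M : Type*} [AddCommGroup M] [Module K M] [LeftComodule K C M]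
    (X : Submodule K M) :
    IsLeftSubcomodule K C X ↔ ∀ (f : (DualAlgebra K C)ᵐᵒᵖ), ∀ m ∈ X, f • m ∈ X := by
  constructor
  · intro h f m hm
    obtain ⟨t, ht⟩ := h (Submodule.mem_map_of_mem hm)
    rw [leftComodule_smul_def, ← ht, slice_lTensor]
    exact Submodule.coe_mem _
  · rintro h _ ⟨m, hm, rfl⟩
    rw [← LinearMap.exact_iff.1 (lTensor_exact C (LinearMap.exact_subtype_mkQ X) X.mkQ_surjective),
      LinearMap.mem_ker]
    refine left_tensor_ext_of_slices fun f => ?_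
    rw [slice_lTensor, map_zero, map_zero]
    exact (Submodule.Quotient.mk_eq_zero X).2 (h (MulOpposite.op (WithConv.toConv f)) m hm)

end Sides

open DualAction

/-! ### Duals of rational modules -/

section Duals

variable {K C : Type*} [Field K] [AddCommGroup C] [Module K C] [Coalgebra K C]

/-- The left `C^*`-module structure `(f u)(n) = u(n f)` on the dual of a right `C^*`-module. -/
noncomputable instance leftDualModule (N : Type*) [AddCommGroup N] [Module K N]
    [Module (DualAlgebra K C)ᵐᵒᵖ N] [IsScalarTower K (DualAlgebra K C)ᵐᵒᵖ N] :
    Module (DualAlgebra K C) (Module.Dual K N) where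
  smul f u := u ∘ₗ Algebra.lsmul K K N (MulOpposite.op f)
  one_smul u := LinearMap.ext fun n => congrArg u (one_smul (DualAlgebra K C)ᵐᵒᵖ n)
  mul_smul f g u := LinearMap.ext fun n => congrArg u
    (mul_smul (MulOpposite.op g) (MulOpposite.op f) n)
  smul_zero _ := LinearMap.zero_comp _
  smul_add _ _ _ := LinearMap.add_comp _ _ _
  add_smul f g u := LinearMap.ext fun n => (congrArg u
    (add_smul (MulOpposite.op f) (MulOpposite.op g) n)).trans (map_add u _ _)
  zero_smul u := LinearMap.ext fun n => (congrArg u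
    (zero_smul (DualAlgebra K C)ᵐᵒᵖ n)).trans (map_zero u)

/-- The right `C^*`-module structure `(u f)(n) = u(f n)` on the dual of a left `C^*`-module. -/
noncomputable instance rightDualModule (N : Type*) [AddCommGroup N] [Module K N]
    [Module (DualAlgebra K C) N] [IsScalarTower K (DualAlgebra K C) N] :
    Module (DualAlgebra K C)ᵐᵒᵖ (Module.Dual K N) where
  smul f u := u ∘ₗ Algebra.lsmul K K N f.unop
  one_smul u := LinearMap.ext fun n => congrArg u (one_smul (DualAlgebra K C) n)
  mul_smul f g u := LinearMap.ext fun n => congrArg u (mul_smul g.unop f.unop n)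
  smul_zero _ := LinearMap.zero_comp _
  smul_add _ _ _ := LinearMap.add_comp _ _ _
  add_smul f g u := LinearMap.ext fun n => (congrArg u
    (add_smul f.unop g.unop n)).trans (map_add u _ _)
  zero_smul u := LinearMap.ext fun n => (congrArg u
    (zero_smul (DualAlgebra K C) n)).trans (map_zero u)

/-- The regular left module structure takes precedence over the one that `C^*` carries as the dual
of the right `C^*`-module `C`. -/
noncomputable instance (priority := 10000) dualAlgebraLeftModule :
    Module (DualAlgebra K C) (DualAlgebra K C) :=
  Semiring.toModule

/-- The regular right module structure takes precedence over the one that `C^*` carries as the dual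
of the left `C^*`-module `C`. -/
noncomputable instance (priority := 10000) dualAlgebraRightModule :
    Module (DualAlgebra K C)ᵐᵒᵖ (DualAlgebra K C) :=
  Semiring.toOppositeModule

section LeftDual

variable {N : Type*} [AddCommGroup N] [Module K N]
    [Module (DualAlgebra K C)ᵐᵒᵖ N] [IsScalarTower K (DualAlgebra K C)ᵐᵒᵖ N]

theorem leftDual_smul_apply (f : DualAlgebra K C) (u : Module.Dual K N) (n : N) :
    (f • u) n = u (MulOpposite.op f • n) := rfl

instance leftDual_isScalarTower : IsScalarTower K (DualAlgebra K C) (Module.Dual K N) where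
  smul_assoc k f u := LinearMap.ext fun n => by
    rw [leftDual_smul_apply, LinearMap.smul_apply, leftDual_smul_apply, MulOpposite.op_smul,
      smul_assoc, map_smul]

theorem IsRational.leftDual [Module.Finite K N] (hN : IsRational (DualAlgebra K C)ᵐᵒᵖ N) :
    IsRational (DualAlgebra K C) (Module.Dual K N) := by
  classical
  intro u
  let b := Module.finBasis K N
  choose F hF using fun i => hN (b i)
  refine ⟨Finset.univ.biUnion F, fun r hr => b.ext fun i => ?_⟩
  rw [leftDual_smul_apply, hF i (MulOpposite.op r), map_zero, LinearMap.zero_apply]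
  exact fun c hc => hr c (Finset.mem_biUnion.2 ⟨i, Finset.mem_univ i, hc⟩)

end LeftDual

section RightDual

variable {N : Type*} [AddCommGroup N] [Module K N]
    [Module (DualAlgebra K C) N] [IsScalarTower K (DualAlgebra K C) N]

theorem rightDual_smul_apply (f : (DualAlgebra K C)ᵐᵒᵖ) (u : Module.Dual K N) (n : N) :
    (f • u) n = u (f.unop • n) := rfl

instance rightDual_isScalarTower : IsScalarTower K (DualAlgebra K C)ᵐᵒᵖ (Module.Dual K N) where
  smul_assoc k f u := LinearMap.ext fun n => by
    rw [rightDual_smul_apply, LinearMap.smul_apply, rightDual_smul_apply, MulOpposite.unop_smul,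
      smul_assoc, map_smul]

theorem IsRational.rightDual [Module.Finite K N] (hN : IsRational (DualAlgebra K C) N) :
    IsRational (DualAlgebra K C)ᵐᵒᵖ (Module.Dual K N) := by
  classical
  intro u
  let b := Module.finBasis K N
  choose F hF using fun i => hN (b i)
  refine ⟨Finset.univ.biUnion F, fun r hr => b.ext fun i => ?_⟩
  rw [rightDual_smul_apply, hF i r.unop, map_zero, LinearMap.zero_apply]
  exact fun c hc => hr c (Finset.mem_biUnion.2 ⟨i, Finset.mem_univ i, hc⟩)

end RightDual

end Duals

/-! ### Essential simple submodules and the Loewy series -/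

section Module

variable {R M : Type*} [Ring R] [AddCommGroup M] [Module R M]

/-- `S` is the least nonzero submodule of `X`; equivalently, `S` is simple and essential
in `X`. -/
def IsEssentialSimple (S X : Submodule R M) : Prop :=
  S ≠ ⊥ ∧ S ≤ X ∧ ∀ Y ≤ X, Y ≠ ⊥ → S ≤ Y

/-- The Loewy series stabilizes, and can do so only at the whole module, because a nonzero module
of finite length has a nonzero socle. -/
theorem hasFiniteLoewyLength_of_finiteLength [IsNoetherian R M] [IsArtinian R M] :
    HasFiniteLoewyLength R M := by
  have hmono : Monotone (loewySeries R M) := monotone_nat_of_le_succ fun n => by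
    rw [loewySeries]
    exact le_trans (by rw [Submodule.comap_bot, Submodule.ker_mkQ]) (Submodule.comap_mono bot_le)
  obtain ⟨n, hn⟩ := monotone_stabilizes_iff_noetherian.2 ‹_› ⟨loewySeries R M, hmono⟩
  refine ⟨n, ?_⟩
  have h1 : loewySeries R M n = loewySeries R M (n + 1) := hn (n + 1) n.le_succ
  by_contra htop
  have : Nontrivial (M ⧸ loewySeries R M n) := Submodule.Quotient.nontrivial_iff.2 htop
  obtain ⟨T, hT, -⟩ := (eq_bot_or_exists_atom_le
    (⊤ : Submodule R (M ⧸ loewySeries R M n))).resolve_left top_ne_bot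
  have hTs : T ≤ socle R (M ⧸ loewySeries R M n) :=
    le_sSup (isSimpleModule_iff_isAtom.2 hT)
  have h2 : socle R (M ⧸ loewySeries R M n) = ⊥ := by
    rw [loewySeries] at h1
    rw [eq_bot_iff, ← Submodule.map_comap_eq_of_surjective (Submodule.mkQ_surjective _)
      (socle R (M ⧸ loewySeries R M n)), ← h1, Submodule.map_le_iff_le_comap]
    exact (by rw [Submodule.comap_bot, Submodule.ker_mkQ])
  exact hT.1 (le_bot_iff.1 (h2 ▸ hTs))

/-- The essential simple submodule of `X` contains the intersection of `X` with the socle. -/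
theorem IsEssentialSimple.mem_of_mem_socle {S X : Submodule R M} (h : IsEssentialSimple S X)
    {x : M} (hx : x ∈ X) (hs : x ∈ socle R M) : x ∈ S := by
  have hss : IsSemisimpleModule R (socle R M) := by
    rw [socle, sSup_eq_iSup]
    exact isSemisimpleModule_biSup_of_isSemisimpleModule_submodule fun T hT => by
      have : IsSimpleModule R T := hT
      infer_instance
  by_cases h0 : x = 0
  · rw [h0]; exact S.zero_mem
  let Y := Submodule.span R {x}
  have hY : Y ≤ X := (Submodule.span_singleton_le_iff_mem _ _).2 hx
  have hYs : Y ≤ socle R M := (Submodule.span_singleton_le_iff_mem _ _).2 hs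
  have hY0 : Y ≠ ⊥ := by simpa [Y] using h0
  have hSY := h.2.2 Y hY hY0
  have hYss : IsSemisimpleModule R Y :=
    IsSemisimpleModule.of_injective _ (Submodule.inclusion_injective hYs)
  obtain ⟨Q, hQ⟩ := exists_isCompl (S.comap Y.subtype)
  have hQ0 : Q = ⊥ := by
    by_contra hne
    have h1 : S ≤ Q.map Y.subtype := h.2.2 _ ((Submodule.map_subtype_le _ _).trans hY)
      fun h0 => hne (Submodule.map_injective_of_injective Y.injective_subtype
        (h0.trans (Submodule.map_bot _).symm))
    apply h.1
    rw [eq_bot_iff]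
    intro s hsS
    obtain ⟨q, hq, rfl⟩ := h1 hsS
    have := hQ.disjoint.le_bot (⟨hsS, hq⟩ : q ∈ S.comap Y.subtype ⊓ Q)
    rw [Submodule.mem_bot] at this ⊢
    simp [this]
  have h2 : S.comap Y.subtype = ⊤ := by simpa [hQ0] using hQ.sup_eq_top
  have h3 : (⟨x, Submodule.mem_span_singleton_self x⟩ : Y) ∈ S.comap Y.subtype :=
    h2 ▸ Submodule.mem_top
  exact h3

/-- A direct summand of a direct summand is a direct summand. -/
theorem exists_isCompl_map_subtype {D : Type*} [AddCommGroup D] [Module R D] {X Z : Submodule R D}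
    (hXZ : IsCompl X Z) {X₁ X₂ : Submodule R X} (h : IsCompl X₁ X₂) :
    ∃ Z', IsCompl (X₁.map X.subtype) Z' := by
  refine ⟨X₂.map X.subtype ⊔ Z, ?_, ?_⟩
  · have hd : Disjoint (X₁.map X.subtype) (X₂.map X.subtype) :=
      Submodule.disjoint_map X.injective_subtype h.disjoint
    refine hd.disjoint_sup_right_of_disjoint_sup_left (hXZ.disjoint.mono_left ?_)
    exact sup_le (Submodule.map_subtype_le _ _) (Submodule.map_subtype_le _ _)
  · rw [codisjoint_iff, ← sup_assoc, ← Submodule.map_sup, h.sup_eq_top, Submodule.map_top,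
      Submodule.range_subtype, hXZ.sup_eq_top]

/-- Suppose that for any two disjoint submodules some endomorphism is the identity on the first
and zero on the second, as holds for self-injective modules. Then a property that passes from the
sum of two submodules to one of them, and that holds for the whole module of finite length, holds
for a submodule with an essential simple submodule: a minimal direct summand with the
property is indecomposable, so each of its endomorphisms is nilpotent or injective. -/
theorem exists_isEssentialSimple_of_sup {D : Type*} [AddCommGroup D] [Module R D]
    [IsNoetherian R D] [IsArtinian R D]
    (hinj : ∀ T Y : Submodule R D, Disjoint T Y →
      ∃ F : D →ₗ[R] D, (∀ t ∈ T, F t = t) ∧ ∀ y ∈ Y, F y = 0)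
    (P : Submodule R D → Prop) (htop : P ⊤) (hbot : ¬ P ⊥)
    (hsup : ∀ X Y, P (X ⊔ Y) → P X ∨ P Y) :
    ∃ T X : Submodule R D, P X ∧ IsEssentialSimple T X := by
  obtain ⟨X, ⟨⟨Z, hXZ⟩, hPX⟩, hmin⟩ := exists_minimal_of_wellFoundedLT
    (fun X : Submodule R D => (∃ Z, IsCompl X Z) ∧ P X) ⟨⊤, ⟨⊥, isCompl_top_bot⟩, htop⟩
  have hX0 : X ≠ ⊥ := fun h => hbot (h ▸ hPX)
  obtain ⟨T, hT, hTX⟩ := (eq_bot_or_exists_atom_le X).resolve_left hX0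
  refine ⟨T, X, hPX, hT.1, hTX, fun Y hYX hY0 => ?_⟩
  by_contra hTY
  have hdisj : Disjoint T Y := by
    rw [disjoint_iff]
    by_contra hne
    have := (hT.le_iff.1 (inf_le_left : T ⊓ Y ≤ T)).resolve_left hne
    exact hTY (this ▸ inf_le_right)
  obtain ⟨F, hF1, hF2⟩ := hinj T Y hdisj
  let e := Submodule.projectionOnto X Z hXZ
  let a : Module.End R X := e ∘ₗ F ∘ₗ X.subtype
  have ha1 : ∀ t (ht : t ∈ T), a ⟨t, hTX ht⟩ = ⟨t, hTX ht⟩ := fun t ht => by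
    simp only [a, LinearMap.comp_apply, Submodule.subtype_apply, hF1 t ht]
    exact Submodule.projectionOnto_apply_left hXZ ⟨t, hTX ht⟩
  have ha2 : ∀ y (hy : y ∈ Y), a ⟨y, hYX hy⟩ = 0 := fun y hy => by
    simp only [a, LinearMap.comp_apply, Submodule.subtype_apply, hF2 y hy, map_zero]
  obtain ⟨k, hk, hk1⟩ := (a.eventually_isCompl_ker_pow_range_pow.and
    (Filter.eventually_ge_atTop 1)).exists
  have hsummand : ∀ X₁ X₂ : Submodule R X, IsCompl X₁ X₂ → P (X₁.map X.subtype) → X₁ = ⊤ := by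
    intro X₁ X₂ h12 hP
    have hle : X ≤ X₁.map X.subtype :=
      hmin ⟨exists_isCompl_map_subtype hXZ h12, hP⟩ (Submodule.map_subtype_le _ _)
    rw [Submodule.eq_top_iff']
    intro x
    obtain ⟨x', hx', hxx⟩ := hle x.2
    rwa [← Subtype.ext hxx]
  have hP' : P ((LinearMap.ker (a ^ k)).map X.subtype) ∨
      P ((LinearMap.range (a ^ k)).map X.subtype) := by
    refine hsup _ _ ?_
    rw [← Submodule.map_sup, hk.sup_eq_top, Submodule.map_top, Submodule.range_subtype]
    exact hPX
  rcases hP' with h | h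
  · have h1 := hsummand _ _ hk h
    apply hT.1
    rw [eq_bot_iff]
    intro t ht
    have h2 : ∀ n : ℕ, (a ^ n) ⟨t, hTX ht⟩ = ⟨t, hTX ht⟩ := fun n => by
      induction n with
      | zero => rfl
      | succ n ih => rw [pow_succ, Module.End.mul_apply, ha1 t ht, ih]
    have h3 : (a ^ k) ⟨t, hTX ht⟩ = 0 := LinearMap.mem_ker.1 (h1 ▸ Submodule.mem_top)
    rw [h2] at h3
    exact congrArg Subtype.val h3
  · have h1 := hsummand _ _ hk.symm h
    have h2 : LinearMap.ker (a ^ k) = ⊥ := by simpa [h1] using hk.inf_eq_bot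
    apply hY0
    rw [eq_bot_iff]
    intro y hy
    have h3 : (⟨y, hYX hy⟩ : X) ∈ LinearMap.ker (a ^ k) := by
      rw [LinearMap.mem_ker, ← Nat.sub_add_cancel hk1, pow_succ, Module.End.mul_apply, ha2 y hy,
        map_zero]
    rw [h2] at h3
    exact congrArg Subtype.val ((Submodule.mem_bot R).1 h3)

end Module

/-! ### The annihilator of the coradical -/

section Coradical

theorem map_mem_socle {R T M : Type*} [Ring R] [AddCommGroup T] [Module R T] [IsSimpleModule R T]
    [AddCommGroup M] [Module R M] (θ : T →ₗ[R] M) (t : T) : θ t ∈ socle R M := by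
  rcases LinearMap.injective_or_eq_zero θ with h | h
  · have : IsSimpleModule R (LinearMap.range θ) :=
      (LinearEquiv.ofInjective θ h).isSimpleModule_iff.1 inferInstance
    exact le_sSup (show LinearMap.range θ ∈ {N : Submodule R M | IsSimpleModule R N} from this)
      (LinearMap.mem_range_self θ t)
  · rw [h]
    exact Submodule.zero_mem _

theorem socle_induction {R M : Type*} [Ring R] [AddCommGroup M] [Module R M] {p : M → Prop}
    (h0 : p 0) (hadd : ∀ x y, p x → p y → p (x + y))
    (hsimple : ∀ T : Submodule R M, IsSimpleModule R T → ∀ t ∈ T, p t) {x : M}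
    (hx : x ∈ socle R M) : p x := by
  rw [socle, sSup_eq_iSup'] at hx
  exact Submodule.iSup_induction (motive := p) _ hx (fun T t ht => hsimple T.1 T.2 t ht) h0 hadd

variable (K C : Type*) [Field K] [AddCommGroup C] [Module K C] [Coalgebra K C]

/-- The functionals on `C` vanishing on the coradical, that is, on the socle of `C` as a right
comodule; this is the Jacobson radical of the dual algebra. -/
noncomputable def coradicalAnnihilator : Submodule K (DualAlgebra K C) where
  carrier := {f | ∀ c ∈ socle (DualAlgebra K C) C, eval f c = 0}
  add_mem' hf hg c hc := by rw [map_add, LinearMap.add_apply, hf c hc, hg c hc, add_zero]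
  zero_mem' c _ := by rw [map_zero, LinearMap.zero_apply]
  smul_mem' k f hf c hc := by rw [map_smul, LinearMap.smul_apply, hf c hc, smul_zero]

variable {K C}

theorem coradicalAnnihilator_pow_succ (n : ℕ) : coradicalAnnihilator K C ^ (n + 1) =
    coradicalAnnihilator K C * coradicalAnnihilator K C ^ n := by
  rcases Nat.eq_zero_or_pos n with rfl | hn
  · rw [zero_add, Submodule.pow_one, Submodule.pow_zero, Submodule.mul_one]
  · exact Submodule.pow_succ' _ hn.ne'

/-- An element of `C` killed by the annihilator of the coradical lies in the coradical. -/
theorem mem_socle_of_smul_eq_zero {c : C}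
    (h : ∀ f ∈ coradicalAnnihilator K C, f • c = 0) : c ∈ socle (DualAlgebra K C) C := by
  by_contra hc
  obtain ⟨φ, hφ, hφ'⟩ := Submodule.exists_dual_map_eq_bot_of_notMem
    (p := (socle (DualAlgebra K C) C).restrictScalars K) hc inferInstance
  let f : DualAlgebra K C := (eval (K := K) (C := C)).symm φ
  have hf : ∀ c, eval f c = φ c := fun c => by simp [f]
  have hmem : f ∈ coradicalAnnihilator K C := fun d hd => by
    rw [hf]
    exact (Submodule.eq_bot_iff _).1 hφ' _ (Submodule.mem_map_of_mem hd)
  have h1 := eval_smul (1 : DualAlgebra K C) f c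
  rw [h f hmem, map_zero, one_mul, hf] at h1
  exact hφ h1.symm

/-- The annihilator of the coradical kills simple rational left modules, as their matrix
coefficients lie in the coradical. -/
theorem smul_eq_zero_of_isSimpleModule_left {T : Type*} [AddCommGroup T] [Module K T]
    [Module (DualAlgebra K C) T] [IsScalarTower K (DualAlgebra K C) T]
    [IsSimpleModule (DualAlgebra K C) T] (hT : IsRational (DualAlgebra K C) T)
    {f : DualAlgebra K C} (hf : f ∈ coradicalAnnihilator K C) (t : T) : f • t = 0 := by
  rw [← Module.forall_dual_apply_eq_zero_iff K]
  intro u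
  obtain ⟨θ, hθ⟩ := hT.exists_coefficient_map u
  rw [← hθ]
  exact hf _ (map_mem_socle θ t)

/-- A nonzero functional on a simple module has no nonzero vector in the kernel of its matrix
coefficients, so it generates the dual. -/
theorem isSimpleModule_leftDual {S : Type*} [AddCommGroup S] [Module K S]
    [Module (DualAlgebra K C)ᵐᵒᵖ S] [IsScalarTower K (DualAlgebra K C)ᵐᵒᵖ S]
    [IsSimpleModule (DualAlgebra K C)ᵐᵒᵖ S] (hS : IsRational (DualAlgebra K C)ᵐᵒᵖ S) :
    IsSimpleModule (DualAlgebra K C) (Module.Dual K S) := by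
  rw [isSimpleModule_iff_toSpanSingleton_surjective]
  have := IsSimpleModule.nontrivial (DualAlgebra K C)ᵐᵒᵖ S
  refine ⟨inferInstance, fun u hu v => ?_⟩
  obtain ⟨r, hr⟩ := hS.exists_functional_eq (u := u) (fun m hm => by
    by_contra hm0
    apply hu
    ext x
    obtain ⟨r, rfl⟩ := IsSimpleModule.toSpanSingleton_surjective (DualAlgebra K C)ᵐᵒᵖ hm0 x
    exact hm r) v
  exact ⟨r.unop, LinearMap.ext fun x => (hr x).symm⟩

/-- The annihilator of the coradical also kills simple rational right modules, as their duals are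
simple left modules: the coradical is the same on both sides. -/
theorem smul_eq_zero_of_isSimpleModule_right {S : Type*} [AddCommGroup S] [Module K S]
    [Module (DualAlgebra K C)ᵐᵒᵖ S] [IsScalarTower K (DualAlgebra K C)ᵐᵒᵖ S]
    [IsSimpleModule (DualAlgebra K C)ᵐᵒᵖ S] (hS : IsRational (DualAlgebra K C)ᵐᵒᵖ S)
    {f : DualAlgebra K C} (hf : f ∈ coradicalAnnihilator K C) (s : S) :
    MulOpposite.op f • s = 0 := by
  have hsimple := isSimpleModule_leftDual hS
  have hfin : Module.Finite K S := by
    have h : (⊤ : Submodule (DualAlgebra K C)ᵐᵒᵖ S).FG := Module.Finite.fg_top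
    have h1 := hS.finite_of_fg (K := K) h
    exact Module.Finite.of_surjective
      ((⊤ : Submodule (DualAlgebra K C)ᵐᵒᵖ S).subtype.restrictScalars K)
      fun s => ⟨⟨s, Submodule.mem_top⟩, rfl⟩
  rw [← Module.forall_dual_apply_eq_zero_iff K]
  intro u
  rw [← leftDual_smul_apply, smul_eq_zero_of_isSimpleModule_left hS.leftDual hf u,
    LinearMap.zero_apply]

theorem smul_eq_zero_of_mem_loewySeries_left {M : Type*} [AddCommGroup M] [Module K M]
    [Module (DualAlgebra K C) M] [IsScalarTower K (DualAlgebra K C) M]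
    (hM : IsRational (DualAlgebra K C) M) (n : ℕ) :
    ∀ f ∈ coradicalAnnihilator K C ^ n, ∀ x ∈ loewySeries (DualAlgebra K C) M n, f • x = 0 := by
  induction n with
  | zero =>
    intro f _ x hx
    rw [(Submodule.mem_bot _).1 hx, smul_zero]
  | succ n ih =>
    intro f hf x hx
    rw [Submodule.pow_succ] at hf
    induction hf using Submodule.mul_induction_on' with
    | mem_mul_mem g hg h hh =>
      rw [mul_smul]
      refine ih g hg _ ?_
      rw [← Submodule.Quotient.mk_eq_zero, Submodule.Quotient.mk_smul]
      refine socle_induction (p := fun y : M ⧸ loewySeries (DualAlgebra K C) M n => h • y = 0)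
        (smul_zero h)
        (fun y z hy hz => by rw [smul_add, hy, hz, add_zero]) (fun T hT t ht => ?_)
        (Submodule.mem_comap.1 hx)
      exact congrArg Subtype.val (smul_eq_zero_of_isSimpleModule_left
        ((hM.quotient _).submodule T) hh ⟨t, ht⟩)
    | add g _ h _ hg hh => rw [add_smul, hg, hh, add_zero]

theorem smul_eq_zero_of_mem_loewySeries_right {M : Type*} [AddCommGroup M] [Module K M]
    [Module (DualAlgebra K C)ᵐᵒᵖ M] [IsScalarTower K (DualAlgebra K C)ᵐᵒᵖ M]
    (hM : IsRational (DualAlgebra K C)ᵐᵒᵖ M) (n : ℕ) :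
    ∀ f ∈ coradicalAnnihilator K C ^ n, ∀ x ∈ loewySeries (DualAlgebra K C)ᵐᵒᵖ M n,
      MulOpposite.op f • x = 0 := by
  induction n with
  | zero =>
    intro f _ x hx
    rw [(Submodule.mem_bot _).1 hx, smul_zero]
  | succ n ih =>
    intro f hf x hx
    rw [coradicalAnnihilator_pow_succ] at hf
    induction hf using Submodule.mul_induction_on' with
    | mem_mul_mem g hg h hh =>
      rw [MulOpposite.op_mul, mul_smul]
      refine ih h hh _ ?_
      rw [← Submodule.Quotient.mk_eq_zero, Submodule.Quotient.mk_smul]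
      refine socle_induction (p := fun y : M ⧸ loewySeries (DualAlgebra K C)ᵐᵒᵖ M n =>
        MulOpposite.op g • y = 0) (smul_zero _)
        (fun y z hy hz => by rw [smul_add, hy, hz, add_zero]) (fun T hT t ht => ?_)
        (Submodule.mem_comap.1 hx)
      exact congrArg Subtype.val (smul_eq_zero_of_isSimpleModule_right
        ((hM.quotient _).submodule T) hg ⟨t, ht⟩)
    | add g _ h _ hg hh => rw [MulOpposite.op_add, add_smul, hg, hh, add_zero]

/-- If the coradical filtration of `C` is finite then the annihilator of the coradical is
nilpotent. -/
theorem eq_zero_of_mem_pow_of_loewySeries_eq_top {n : ℕ}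
    (h : loewySeries (DualAlgebra K C) C n = ⊤) {f : DualAlgebra K C}
    (hf : f ∈ coradicalAnnihilator K C ^ n) : f = 0 := by
  apply (eval (K := K) (C := C)).injective
  ext c
  have h1 := smul_eq_zero_of_mem_loewySeries_left (isRational_self (R := DualAlgebra K C)) n f hf c
    (h ▸ Submodule.mem_top)
  have h2 := eval_smul (1 : DualAlgebra K C) f c
  rw [h1, map_zero, one_mul] at h2
  rw [← h2, map_zero, LinearMap.zero_apply]

end Coradical

/-! ### Injectivity of the coalgebra and injective hulls -/

section Injective

variable {K C : Type*} [Field K] [AddCommGroup C] [Module K C]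

theorem exists_functional_of_disjoint {T Y : Submodule K C} (h : Disjoint T Y) (ψ : C →ₗ[K] K) :
    ∃ φ : C →ₗ[K] K, (∀ t ∈ T, φ t = ψ t) ∧ ∀ y ∈ Y, φ y = 0 := by
  obtain ⟨Z, hYZ, hTZ⟩ := h.symm.exists_isCompl
  have hZ := hTZ.symm
  refine ⟨ψ ∘ₗ T.subtype ∘ₗ Submodule.projectionOnto T Z hZ, fun t ht => ?_, fun y hy => ?_⟩
  · have := Submodule.projectionOnto_apply_left hZ ⟨t, ht⟩
    simp only [LinearMap.comp_apply]
    exact congrArg (fun z => ψ (T.subtype z)) this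
  · have := Submodule.projectionOnto_apply_right hZ ⟨y, hYZ hy⟩
    simp only [LinearMap.comp_apply]
    rw [this, map_zero, map_zero]

/-- A retract `E` of `C` is injective with respect to embeddings into rational modules. -/
theorem IsRational.exists_extension {R : Type*} [Ring R] [Algebra K R] [Module R C]
    [DualAction K C R] {E : Submodule R C} (π : C →ₗ[R] E) (hπ : ∀ e : E, π e = e)
    {N B : Type*} [AddCommGroup N] [Module K N] [Module R N] [IsScalarTower K R N]
    [AddCommGroup B] [Module K B] [Module R B] [IsScalarTower K R B] (hB : IsRational R B)
    (ν : N →ₗ[R] B) (hν : Function.Injective ν) (f : N →ₗ[R] E) :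
    ∃ h : B →ₗ[R] E, ∀ n, h (ν n) = f n := by
  obtain ⟨l, hl⟩ := (ν.restrictScalars K).exists_leftInverse_of_injective
    (LinearMap.ker_eq_bot.2 hν)
  obtain ⟨θ, hθ⟩ := hB.exists_coefficient_map
    (eval (1 : R) ∘ₗ E.subtype.restrictScalars K ∘ₗ f.restrictScalars K ∘ₗ l)
  refine ⟨π ∘ₗ θ, fun n => ?_⟩
  have h1 : θ (ν n) = f n := by
    refine eval_ext (R := R) fun r => ?_
    have h2 : l (ν (r • n)) = r • n := LinearMap.congr_fun hl (r • n)
    rw [hθ, ← map_smul]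
    simp only [LinearMap.comp_apply, LinearMap.restrictScalars_apply, h2]
    rw [map_smul, map_smul, Submodule.subtype_apply, eval_smul, one_mul]
  rw [LinearMap.comp_apply, h1, hπ]

variable [Coalgebra K C]

/-- The endomorphism `c ↦ f c` of `C` as a right `C^*`-module. -/
noncomputable def leftSMul (f : DualAlgebra K C) : C →ₗ[(DualAlgebra K C)ᵐᵒᵖ] C where
  toFun c := f • c
  map_add' := smul_add f
  map_smul' g c := smul_op_smul_comm f g c

/-- The endomorphism `c ↦ c f` of `C` as a left `C^*`-module. -/
noncomputable def rightSMul (f : (DualAlgebra K C)ᵐᵒᵖ) : C →ₗ[DualAlgebra K C] C where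
  toFun c := f • c
  map_add' := smul_add f
  map_smul' g c := (smul_op_smul_comm g f c).symm

theorem eval_left_smul (f g : DualAlgebra K C) (c : C) :
    eval g (f • c) = eval f (MulOpposite.op g • c) := by
  rw [eval_smul]
  exact (eval_smul (MulOpposite.op f) (MulOpposite.op g) c).symm

/-- Extend the restriction of the counit to `T` by zero on `Y`. -/
theorem exists_leftSMul_of_disjoint {T Y : Submodule (DualAlgebra K C)ᵐᵒᵖ C} (h : Disjoint T Y) :
    ∃ f : DualAlgebra K C, (∀ t ∈ T, f • t = t) ∧ ∀ y ∈ Y, f • y = 0 := by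
  obtain ⟨φ, hφ, hφ'⟩ := exists_functional_of_disjoint (K := K)
    ((Submodule.disjoint_restrictScalars_iff K).2 h) (eval (1 : DualAlgebra K C))
  have hev : ∀ c, eval (WithConv.toConv φ : DualAlgebra K C) c = φ c := fun c => rfl
  refine ⟨WithConv.toConv φ, fun t ht => eval_ext (R := DualAlgebra K C) fun g => ?_,
    fun y hy => eval_ext (R := DualAlgebra K C) fun g => ?_⟩
  · rw [eval_left_smul, hev, hφ _ (T.smul_mem (MulOpposite.op g) ht), ← eval_left_smul, one_smul]
  · rw [eval_left_smul, hev, hφ' _ (Y.smul_mem (MulOpposite.op g) hy), map_zero]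

/-- The mirror image of `exists_leftSMul_of_disjoint`. -/
theorem exists_rightSMul_of_disjoint {T Y : Submodule (DualAlgebra K C) C} (h : Disjoint T Y) :
    ∃ f : (DualAlgebra K C)ᵐᵒᵖ, (∀ t ∈ T, f • t = t) ∧ ∀ y ∈ Y, f • y = 0 := by
  obtain ⟨φ, hφ, hφ'⟩ := exists_functional_of_disjoint (K := K)
    ((Submodule.disjoint_restrictScalars_iff K).2 h) (eval (1 : DualAlgebra K C))
  have hev : ∀ c, eval (WithConv.toConv φ : DualAlgebra K C) c = φ c := fun c => rfl
  refine ⟨MulOpposite.op (WithConv.toConv φ),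
    fun t ht => eval_ext (R := DualAlgebra K C) fun g => ?_,
    fun y hy => eval_ext (R := DualAlgebra K C) fun g => ?_⟩
  · rw [← eval_left_smul, hev, hφ _ (T.smul_mem g ht), eval_smul, one_mul]
  · rw [← eval_left_smul, hev, hφ' _ (Y.smul_mem g hy), map_zero]

/-- Every simple right submodule of `C` is essential in a retract of `C`, its injective hull. -/
theorem exists_retract_of_isAtom {S : Submodule (DualAlgebra K C)ᵐᵒᵖ C} (hS : IsAtom S) :
    ∃ (E : Submodule (DualAlgebra K C)ᵐᵒᵖ C) (π : C →ₗ[(DualAlgebra K C)ᵐᵒᵖ] E),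
      IsEssentialSimple S E ∧ ∀ e : E, π e = e := by
  obtain ⟨E, -, hE⟩ := zorn_le_nonempty₀ {E | IsEssentialSimple S E} (fun c hc hchain E₀ hE₀ => by
    refine ⟨sSup c, ⟨hS.1, (hc hE₀).2.1.trans (le_sSup hE₀), fun Y hY hY0 => ?_⟩,
      fun E hE => le_sSup hE⟩
    obtain ⟨y, hy, hy0⟩ := Submodule.exists_mem_ne_zero_of_ne_bot hY0
    obtain ⟨E, hE, hyE⟩ := (Submodule.mem_sSup_of_directed ⟨E₀, hE₀⟩ hchain.directedOn).1 (hY hy)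
    refine ((hc hE).2.2 (Submodule.span _ {y}) ?_ ?_).trans ?_
    · exact (Submodule.span_singleton_le_iff_mem _ _).2 hyE
    · simpa using hy0
    · exact (Submodule.span_singleton_le_iff_mem _ _).2 hy)
    S ⟨hS.1, le_rfl, fun Y hY hY0 => ((hS.le_iff.1 hY).resolve_left hY0).ge⟩
  obtain ⟨Z, -, hZ⟩ := zorn_le_nonempty₀ {Z | Disjoint E Z} (fun c hc hchain Z₀ hZ₀ => by
    refine ⟨sSup c, ?_, fun Z hZ => le_sSup hZ⟩
    rw [Set.mem_ofPred_eq, Submodule.disjoint_def]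
    intro x hxE hx
    obtain ⟨Z, hZ, hxZ⟩ := (Submodule.mem_sSup_of_directed ⟨Z₀, hZ₀⟩ hchain.directedOn).1 hx
    exact Submodule.disjoint_def.1 (hc hZ) x hxE hxZ) ⊥ disjoint_bot_right
  obtain ⟨f, hfE, hfZ⟩ := exists_leftSMul_of_disjoint hZ.prop
  -- the kernel of `f` is `Z`, by maximality of `Z`
  have hker : ∀ Y : Submodule (DualAlgebra K C)ᵐᵒᵖ C, Z ≤ Y → Disjoint E Y → Y = Z :=
    fun Y hZY hY => le_antisymm (hZ.2 hY hZY) hZY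
  have hrange : IsEssentialSimple S (LinearMap.range (leftSMul f)) := by
    refine ⟨hS.1, fun s hs => ⟨s, hfE s (hE.prop.2.1 hs)⟩, fun Y hY hY0 => ?_⟩
    by_contra hSY
    have hd : Disjoint E Y := by
      rw [disjoint_iff]
      by_contra hne
      exact hSY ((hE.prop.2.2 _ inf_le_left hne).trans inf_le_right)
    have h1 : Y.comap (leftSMul f) = Z := by
      refine hker _ (fun z hz => ?_) ?_
      · rw [Submodule.mem_comap, show leftSMul f z = 0 from hfZ z hz]
        exact Y.zero_mem
      · rw [Submodule.disjoint_def]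
        intro x hx hxY
        rw [Submodule.mem_comap, show leftSMul f x = x from hfE x hx] at hxY
        exact Submodule.disjoint_def.1 hd x hx hxY
    apply hY0
    rw [eq_bot_iff]
    intro y hy
    obtain ⟨x, rfl⟩ := hY hy
    have hx : x ∈ Z := h1 ▸ (show x ∈ Y.comap (leftSMul f) from hy)
    exact (Submodule.mem_bot _).2 (hfZ x hx)
  have hle : LinearMap.range (leftSMul f) ≤ E :=
    hE.2 hrange (fun e he => ⟨e, hfE e he⟩)
  exact ⟨E, (leftSMul f).codRestrict E fun c => hle ⟨c, rfl⟩, hE.prop,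
    fun e => Subtype.ext (hfE e e.2)⟩

/-- Every element of `C` lies in a finite dimensional sub-bimodule (a subcoalgebra). -/
theorem exists_finite_bimodule (c : C) :
    ∃ D : Submodule (DualAlgebra K C) C, c ∈ D ∧ Module.Finite K D ∧
      ∀ (g : (DualAlgebra K C)ᵐᵒᵖ), ∀ d ∈ D, g • d ∈ D := by
  have hfin := (isRational_self (R := (DualAlgebra K C)ᵐᵒᵖ)).finite_span_singleton (K := K) c
  obtain ⟨s, hs⟩ : ((Submodule.span (DualAlgebra K C)ᵐᵒᵖ {c}).restrictScalars K).FG :=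
    Module.Finite.iff_fg.1 hfin
  have hle : ∀ x ∈ Submodule.span (DualAlgebra K C)ᵐᵒᵖ {c},
      x ∈ Submodule.span (DualAlgebra K C) (s : Set C) := fun x hx => by
    have hx' : x ∈ (Submodule.span (DualAlgebra K C)ᵐᵒᵖ {c}).restrictScalars K := hx
    rw [← hs] at hx'
    exact Submodule.span_le_restrictScalars K (DualAlgebra K C) (s : Set C) hx'
  refine ⟨Submodule.span (DualAlgebra K C) (s : Set C),
    hle c (Submodule.mem_span_singleton_self c),
    (isRational_self (R := DualAlgebra K C)).finite_of_fg ⟨s, rfl⟩, fun g d hd => ?_⟩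
  induction hd using Submodule.span_induction with
  | mem x hx =>
    have hx' : x ∈ (Submodule.span (DualAlgebra K C)ᵐᵒᵖ {c}).restrictScalars K :=
      hs ▸ Submodule.subset_span hx
    exact hle _ (Submodule.smul_mem _ g hx')
  | zero => rw [smul_zero]; exact Submodule.zero_mem _
  | add x y _ _ hx hy => rw [smul_add]; exact Submodule.add_mem _ hx hy
  | smul f x _ hx => rw [← smul_op_smul_comm]; exact Submodule.smul_mem _ f hx

end Injective

/-! ### Finiteness of injective hulls -/

section Finiteness

theorem IsEssentialSimple.map {R M N : Type*} [Ring R] [AddCommGroup M] [Module R M]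
    [AddCommGroup N] [Module R N] {S X : Submodule R M} (h : IsEssentialSimple S X)
    (f : M →ₗ[R] N) (hf : Function.Injective f) : IsEssentialSimple (S.map f) (X.map f) := by
  refine ⟨fun h0 => h.1 (Submodule.map_injective_of_injective hf
    (h0.trans (Submodule.map_bot f).symm)), Submodule.map_mono h.2.1, fun Y hY hY0 => ?_⟩
  have h1 : (Y.comap f).map f = Y :=
    Submodule.map_comap_eq_self (hY.trans LinearMap.map_le_range)
  have h2 : S ≤ Y.comap f := by
    refine h.2.2 _ (fun x hx => ?_) fun h0 => hY0 (by rw [← h1, h0, Submodule.map_bot])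
    obtain ⟨x', hx', hxx⟩ := hY hx
    rwa [← hf hxx]
  exact (Submodule.map_mono h2).trans h1.le

theorem IsEssentialSimple.comap_subtype {R M : Type*} [Ring R] [AddCommGroup M] [Module R M]
    {S X N : Submodule R M} (h : IsEssentialSimple S X) (hN : N ≤ X) (hN0 : N ≠ ⊥) :
    IsEssentialSimple (S.comap N.subtype) ⊤ := by
  obtain ⟨s₀, hs₀, hs₀0⟩ := Submodule.exists_mem_ne_zero_of_ne_bot h.1
  refine ⟨fun h0 => hs₀0 ?_, le_top, fun Y _ hY0 s hs => ?_⟩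
  · exact congrArg Subtype.val
      ((Submodule.eq_bot_iff _).1 h0 ⟨s₀, h.2.2 N hN hN0 hs₀⟩ hs₀)
  · obtain ⟨y, hy, hys⟩ := h.2.2 (Y.map N.subtype) ((Submodule.map_subtype_le _ _).trans hN)
      (fun h0 => hY0 (Submodule.map_injective_of_injective N.injective_subtype
        (h0.trans (Submodule.map_bot _).symm))) hs
    rwa [← Subtype.ext hys]

/-- A functional not vanishing on the essential simple submodule of `N` generates the dual
of `N`. -/
theorem IsEssentialSimple.exists_smul_eq {K C : Type*} [Field K] [AddCommGroup C] [Module K C]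
    [Coalgebra K C] {N : Type*} [AddCommGroup N] [Module K N] [Module (DualAlgebra K C)ᵐᵒᵖ N]
    [IsScalarTower K (DualAlgebra K C)ᵐᵒᵖ N] {S : Submodule (DualAlgebra K C)ᵐᵒᵖ N}
    (hN : IsRational (DualAlgebra K C)ᵐᵒᵖ N) (hS : IsEssentialSimple S ⊤)
    {u : Module.Dual K N} (hu : ∃ s ∈ S, u s ≠ 0) (v : Module.Dual K N) :
    ∃ f : DualAlgebra K C, f • u = v := by
  obtain ⟨r, hr⟩ := hN.exists_functional_eq (u := u) (fun m hm => by
    by_contra hm0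
    obtain ⟨s, hs, hus⟩ := hu
    obtain ⟨r, rfl⟩ := Submodule.mem_span_singleton.1
      (hS.2.2 (Submodule.span _ {m}) le_top (by simpa using hm0) hs)
    exact hus (hm r)) v
  exact ⟨r.unop, LinearMap.ext fun n => (hr n).symm⟩

variable {K C : Type u} [Field K] [AddCommGroup C] [Module K C] [Coalgebra K C]

/-- The generating condition in terms of rational modules: morphisms from `C` detect proper
subspaces. -/
theorem RightGeneratingCondition.exists_hom (hgen : RightGeneratingCondition K C) {N : Type u}
    [AddCommGroup N] [Module K N] [inst : Module (DualAlgebra K C) N]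
    [IsScalarTower K (DualAlgebra K C) N] (hN : IsRational (DualAlgebra K C) N)
    {W : Submodule K N} (hW : W ≠ ⊤) : ∃ (φ : C →ₗ[DualAlgebra K C] N) (c : C), φ c ∉ W := by
  obtain ⟨hc, rfl⟩ := isRational_left_exists_comodule hN
  obtain ⟨ι, φ, hφ, htop⟩ := hgen N
  by_contra! hall
  refine hW (eq_top_iff.2 (htop ▸ iSup_le fun i => ?_))
  rintro _ ⟨c, rfl⟩
  exact hall ⟨(φ i).toAddHom, (isRightHom_iff (φ i)).1 (hφ i)⟩ c

/-- If `N` is finite dimensional with an essential simple submodule then some morphism from `C` to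
the dual of `N` takes a value generating this dual. -/
theorem RightGeneratingCondition.exists_hom_dual (hgen : RightGeneratingCondition K C) {N : Type u}
    [AddCommGroup N] [Module K N] [Module (DualAlgebra K C)ᵐᵒᵖ N]
    [IsScalarTower K (DualAlgebra K C)ᵐᵒᵖ N] [Module.Finite K N]
    (hN : IsRational (DualAlgebra K C)ᵐᵒᵖ N) {S : Submodule (DualAlgebra K C)ᵐᵒᵖ N}
    (hS : IsEssentialSimple S ⊤) :
    ∃ (φ : C →ₗ[DualAlgebra K C] Module.Dual K N) (c : C), ∃ s ∈ S, φ c s ≠ 0 := by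
  obtain ⟨s, hs, hs0⟩ := Submodule.exists_mem_ne_zero_of_ne_bot hS.1
  obtain ⟨φ, c, hc⟩ := hgen.exists_hom hN.leftDual
    (W := (S.restrictScalars K).dualAnnihilator) fun hW => by
      refine hs0 ((Module.forall_dual_apply_eq_zero_iff K s).1 fun v => ?_)
      exact (Submodule.mem_dualAnnihilator v).1 (hW ▸ Submodule.mem_top) s hs
  refine ⟨φ, c, ?_⟩
  by_contra! h
  exact hc ((Submodule.mem_dualAnnihilator _).2 h)

/-- If `E` has Loewy length at most `k + 1`, then every proper submodule of a finite dimensional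
submodule `N` of `E` has Loewy length at most `k`. -/
theorem RightGeneratingCondition.smul_eq_zero_of_lt (hgen : RightGeneratingCondition K C)
    {S E : Submodule (DualAlgebra K C)ᵐᵒᵖ C} (hS : IsEssentialSimple S E)
    (π : C →ₗ[(DualAlgebra K C)ᵐᵒᵖ] E) (hπ : ∀ e : E, π e = e) {k : ℕ}
    (hk : ∀ f ∈ coradicalAnnihilator K C ^ (k + 1), ∀ x ∈ E, MulOpposite.op f • x = 0)
    {N B : Submodule (DualAlgebra K C)ᵐᵒᵖ C} [Module.Finite K N] (hNE : N ≤ E) (hBN : B < N)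
    {f : DualAlgebra K C} (hf : f ∈ coradicalAnnihilator K C ^ k) {b : C} (hb : b ∈ B) :
    MulOpposite.op f • b = 0 := by
  have hNrat : IsRational (DualAlgebra K C)ᵐᵒᵖ N := isRational_self.submodule N
  have hN0 : N ≠ ⊥ := (bot_le.trans_lt hBN).ne'
  let S' : Submodule (DualAlgebra K C)ᵐᵒᵖ N := S.comap N.subtype
  have hS' : IsEssentialSimple (R := (DualAlgebra K C)ᵐᵒᵖ) (M := N) S' ⊤ :=
    hS.comap_subtype hNE hN0
  have hSne : ∃ s ∈ S', s ≠ 0 := Submodule.exists_mem_ne_zero_of_ne_bot hS'.1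
  -- `φ c` generates the dual of `N` for some morphism `φ` on `C`
  let W : Submodule K (Module.Dual K N) := (S'.restrictScalars K).dualAnnihilator
  have hWmem : ∀ v : Module.Dual K N, v ∉ W → ∃ s ∈ S', v s ≠ 0 := fun v hv => by
    by_contra! h
    exact hv ((Submodule.mem_dualAnnihilator v).2 h)
  obtain ⟨φ, c, s₀, hs₀, hφs₀⟩ := hgen.exists_hom_dual hNrat hS'
  have hφc : φ c ∉ W := fun h => hφs₀ ((Submodule.mem_dualAnnihilator _).1 h s₀ hs₀)
  obtain ⟨D, hcD, hDfin, hDstab⟩ := exists_finite_bimodule (K := K) c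
  have : IsNoetherian (DualAlgebra K C) D := isNoetherian_of_tower K inferInstance
  have : IsArtinian (DualAlgebra K C) D := isArtinian_of_tower K inferInstance
  let P : Submodule (DualAlgebra K C) D → Prop := fun X => ∃ x ∈ X, φ x ∉ W
  obtain ⟨T, X, hPX, hTX⟩ := exists_isEssentialSimple_of_sup (R := DualAlgebra K C) (D := D)
    (fun T Y hTY => by
      obtain ⟨g, hg, hg'⟩ := exists_rightSMul_of_disjoint
        (Submodule.disjoint_map D.injective_subtype hTY)
      refine ⟨((rightSMul g).comp D.subtype).codRestrict D fun d => hDstab g d d.2,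
        fun t ht => ?_, fun y hy => ?_⟩
      · exact Subtype.ext (hg t ⟨t, ht, rfl⟩)
      · exact Subtype.ext (hg' y ⟨y, hy, rfl⟩))
    P ⟨⟨c, hcD⟩, Submodule.mem_top, hφc⟩
    (by
      rintro ⟨x, hx, hxW⟩
      rw [(Submodule.mem_bot _).1 hx, Submodule.coe_zero, map_zero] at hxW
      exact hxW W.zero_mem)
    (by
      rintro X Y ⟨z, hz, hzW⟩
      obtain ⟨x, hx, y, hy, rfl⟩ := Submodule.mem_sup.1 hz
      by_contra! h
      refine hzW ?_
      rw [Submodule.coe_add, map_add]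
      exact W.add_mem (not_not.1 fun h' => h.1 ⟨x, hx, h'⟩) (not_not.1 fun h' => h.2 ⟨y, hy, h'⟩))
  -- a minimal submodule of `X` on which `φ` is surjective
  obtain ⟨X', ⟨hX'X, hPX'⟩, hmin⟩ := exists_minimal_of_wellFoundedLT
    (fun X' : Submodule (DualAlgebra K C) D => X' ≤ X ∧ P X') ⟨X, le_rfl, hPX⟩
  have hsurj : ∀ v : Module.Dual K N, ∃ y ∈ X', φ (y : D) = v := by
    intro v
    obtain ⟨x, hx, hxW⟩ := hPX'
    obtain ⟨g, hg⟩ := hS'.exists_smul_eq hNrat (hWmem _ hxW) v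
    exact ⟨g • x, X'.smul_mem g hx, by rw [Submodule.coe_smul, map_smul, hg]⟩
  -- the dual of `X'` embeds in `E`, so that it has Loewy length at most `k + 1`
  let ν : N →ₗ[(DualAlgebra K C)ᵐᵒᵖ] Module.Dual K X' :=
    { toFun := fun n =>
        { toFun := fun y => φ (y : D) n
          map_add' := fun y z => by
            rw [Submodule.coe_add, Submodule.coe_add, map_add, LinearMap.add_apply]
          map_smul' := fun a y => by
            rw [Submodule.coe_smul_of_tower, Submodule.coe_smul_of_tower,
              LinearMap.map_smul_of_tower, LinearMap.smul_apply, RingHom.id_apply] }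
      map_add' := fun m n => LinearMap.ext fun y => map_add (φ (y : D)) m n
      map_smul' := fun g n => LinearMap.ext fun y => by
        rw [RingHom.id_apply, rightDual_smul_apply]
        change φ (y : D) (g • n) = φ ((g.unop • y : X') : D) n
        rw [Submodule.coe_smul, Submodule.coe_smul, φ.map_smul, leftDual_smul_apply,
          MulOpposite.op_unop] }
  have hν : Function.Injective ν := by
    rw [← LinearMap.ker_eq_bot, LinearMap.ker_eq_bot']
    intro n hn
    refine (Module.forall_dual_apply_eq_zero_iff K n).1 fun v => ?_
    obtain ⟨y, hy, rfl⟩ := hsurj v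
    exact LinearMap.congr_fun hn ⟨y, hy⟩
  have hDrat : IsRational (DualAlgebra K C) D := isRational_self.submodule D
  have hX'fin : Module.Finite K X' :=
    inferInstanceAs (Module.Finite K (X'.restrictScalars K))
  obtain ⟨h, hh⟩ := IsRational.exists_extension π hπ (hDrat.submodule X').rightDual ν hν
    (Submodule.inclusion hNE)
  have hinj : ∀ w, h w = 0 → w = 0 := by
    intro w hw
    let Q : Submodule K (Module.Dual K X') := (LinearMap.ker h).restrictScalars K
    have hQ : ∀ q, h q = 0 → q ∈ Q := fun q hq => hq
    let Y : Submodule (DualAlgebra K C) X' :=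
      { carrier := {y | ∀ q ∈ Q, q y = 0}
        add_mem' := fun hy hz q hq => by rw [map_add, hy q hq, hz q hq, add_zero]
        zero_mem' := fun q _ => map_zero q
        smul_mem' := fun g y hy q hq => by
          refine hy (MulOpposite.op g • q) ?_
          exact hQ _ (by rw [map_smul, show h q = 0 from hq, smul_zero]) }
    by_cases hPY : P (Y.map X'.subtype)
    · have hle := hmin ⟨(Submodule.map_subtype_le _ _).trans hX'X, hPY⟩
        (Submodule.map_subtype_le _ _)
      ext y
      obtain ⟨y', hy', hyy⟩ := hle y.2
      rw [← Subtype.ext hyy]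
      exact hy' w (hQ w hw)
    · exfalso
      obtain ⟨s, hs, hs0⟩ := hSne
      have hνs : ν s ∈ Q := by
        rw [← Subspace.dualCoannihilator_dualAnnihilator_eq (W := Q), Submodule.mem_dualAnnihilator]
        intro y hy
        rw [Submodule.mem_dualCoannihilator] at hy
        by_contra hne
        refine hPY ⟨y, ⟨y, hy, rfl⟩, fun hyW => hne ?_⟩
        exact (Submodule.mem_dualAnnihilator _).1 hyW s hs
      have h0 : h (ν s) = 0 := hνs
      rw [hh] at h0
      exact hs0 (Submodule.inclusion_injective hNE (h0.trans (map_zero _).symm))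
  have hkill : ∀ g ∈ coradicalAnnihilator K C ^ (k + 1), ∀ y : X', g • y = 0 := by
    intro g hg y
    refine (Module.forall_dual_apply_eq_zero_iff K _).1 fun w => ?_
    have h1 : MulOpposite.op g • w = 0 := hinj _ (by
      rw [map_smul]
      exact Subtype.ext (hk g hg _ (h w).2))
    exact LinearMap.congr_fun h1 y
  -- hence the last layer of `X'` lies in the coradical, and so in the essential simple `T`
  have hT : ∀ g ∈ coradicalAnnihilator K C ^ k, ∀ y ∈ X', g • y ∈ T := by
    intro g hg y hy
    have hsoc : ((g • y : D) : C) ∈ socle (DualAlgebra K C) C := by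
      refine mem_socle_of_smul_eq_zero fun g' hg' => ?_
      have h1 := hkill (g' * g) (by
        rw [coradicalAnnihilator_pow_succ]
        exact Submodule.mul_mem_mul hg' hg) ⟨y, hy⟩
      have h2 : (g' * g) • (y : C) = 0 := congrArg (fun z : X' => ((z : D) : C)) h1
      rw [mul_smul] at h2
      exact h2
    obtain ⟨t, ht, hty⟩ := (hTX.map D.subtype D.injective_subtype).mem_of_mem_socle
      ⟨g • y, X.smul_mem g (hX'X hy), rfl⟩ hsoc
    have h3 : t = g • y := Subtype.ext hty
    rwa [← h3]
  -- `φ` maps `T` into the annihilator of `B`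
  obtain ⟨v, hv0, hvB⟩ : ∃ v : Module.Dual K N, v ≠ 0 ∧ ∀ x : N, (x : C) ∈ B → v x = 0 := by
    obtain ⟨x, hxN, hxB⟩ := Set.exists_of_ssubset hBN
    obtain ⟨v, hv, hv'⟩ := Submodule.exists_dual_map_eq_bot_of_notMem
      (p := (B.comap N.subtype).restrictScalars K) (x := ⟨x, hxN⟩) hxB inferInstance
    refine ⟨v, fun h0 => hv (by rw [h0, LinearMap.zero_apply]), fun y hy => ?_⟩
    exact (Submodule.eq_bot_iff _).1 hv' _ (Submodule.mem_map_of_mem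
      (show y ∈ (B.comap N.subtype).restrictScalars K from hy))
  let Y : Submodule (DualAlgebra K C) D :=
    { carrier := {y | y ∈ X ∧ ∀ x : N, (x : C) ∈ B → φ y x = 0}
      add_mem' := fun hy hz => ⟨X.add_mem hy.1 hz.1, fun x hx => by
        rw [Submodule.coe_add, map_add, LinearMap.add_apply, hy.2 x hx, hz.2 x hx, add_zero]⟩
      zero_mem' := ⟨X.zero_mem, fun x _ => by
        rw [Submodule.coe_zero, map_zero, LinearMap.zero_apply]⟩
      smul_mem' := fun g y hy => ⟨X.smul_mem g hy.1, fun x hx => by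
        rw [Submodule.coe_smul, map_smul, leftDual_smul_apply]
        exact hy.2 _ (B.smul_mem _ hx)⟩ }
  have hTY : T ≤ Y := by
    refine hTX.2.2 Y (fun y hy => hy.1) fun h0 => ?_
    obtain ⟨y, hy, rfl⟩ := hsurj v
    have : y ∈ Y := ⟨hX'X hy, hvB⟩
    rw [h0, Submodule.mem_bot] at this
    exact hv0 (by rw [this, Submodule.coe_zero, map_zero])
  have hfin : MulOpposite.op f • (⟨b, hBN.le hb⟩ : N) = 0 := by
    refine (Module.forall_dual_apply_eq_zero_iff K _).1 fun v => ?_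
    obtain ⟨y, hy, rfl⟩ := hsurj v
    rw [← leftDual_smul_apply, ← map_smul]
    exact (hTY (hT f hf y hy)).2 ⟨b, hBN.le hb⟩ hb
  exact congrArg Subtype.val hfin

/-- Injective hulls of finite Loewy length are finite dimensional. -/
theorem RightGeneratingCondition.finite_of_pow_smul_eq_zero (hgen : RightGeneratingCondition K C)
    {S E : Submodule (DualAlgebra K C)ᵐᵒᵖ C} (hS : IsEssentialSimple S E)
    (π : C →ₗ[(DualAlgebra K C)ᵐᵒᵖ] E) (hπ : ∀ e : E, π e = e)
    (h : ∃ n, ∀ f ∈ coradicalAnnihilator K C ^ n, ∀ x ∈ E, MulOpposite.op f • x = 0) :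
    Module.Finite K E := by
  classical
  obtain ⟨s, hs, hs0⟩ := Submodule.exists_mem_ne_zero_of_ne_bot hS.1
  have hn0 : Nat.find h ≠ 0 := fun h0 => by
    have h1 := Nat.find_spec h
    rw [h0, Submodule.pow_zero] at h1
    have h2 := h1 1 (Submodule.one_le.1 le_rfl) s (hS.2.1 hs)
    rw [MulOpposite.op_one, one_smul] at h2
    exact hs0 h2
  obtain ⟨k, hk⟩ := Nat.exists_eq_succ_of_ne_zero hn0
  have h1 := Nat.find_spec h
  rw [hk] at h1
  have h2 := Nat.find_min h (m := k) (by omega)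
  push Not at h2
  obtain ⟨f, hf, x, hx, hfx⟩ := h2
  let N := Submodule.span (DualAlgebra K C)ᵐᵒᵖ {x}
  have hNfin : Module.Finite K N :=
    (isRational_self (R := (DualAlgebra K C)ᵐᵒᵖ)).finite_span_singleton x
  have hNE : N ≤ E := (Submodule.span_singleton_le_iff_mem _ _).2 hx
  have hEN : E ≤ N := by
    intro y hy
    let N' := N ⊔ Submodule.span (DualAlgebra K C)ᵐᵒᵖ {y}
    have hN'fin : Module.Finite K N' := finite_sup hNfin
      ((isRational_self (R := (DualAlgebra K C)ᵐᵒᵖ)).finite_span_singleton y)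
    have hN'E : N' ≤ E := sup_le hNE ((Submodule.span_singleton_le_iff_mem _ _).2 hy)
    have hNN' : N = N' := by
      by_contra hne
      exact hfx (hgen.smul_eq_zero_of_lt hS π hπ h1 hN'E (lt_of_le_of_ne le_sup_left hne) hf
        (Submodule.mem_span_singleton_self x))
    rw [hNN']
    exact Submodule.mem_sup_right (Submodule.mem_span_singleton_self y)
  exact le_antisymm hNE hEN ▸ hNfin

end Finiteness

/-! ### Injective envelopes and the quasi-co-Frobenius property -/

section Envelope

variable {K C : Type u} [Field K] [AddCommGroup C] [Module K C] [Coalgebra K C]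

/-- The hypothesis on Loewy lengths in terms of rational modules. -/
theorem SimpleEnvelopesHaveFiniteLoewyLength.hasFiniteLoewyLength
    (h : SimpleEnvelopesHaveFiniteLoewyLength K C) {S E : Type u} [AddCommGroup S] [Module K S]
    [instS : Module (DualAlgebra K C)ᵐᵒᵖ S] [IsScalarTower K (DualAlgebra K C)ᵐᵒᵖ S]
    [AddCommGroup E] [Module K E]
    [instE : Module (DualAlgebra K C)ᵐᵒᵖ E] [IsScalarTower K (DualAlgebra K C)ᵐᵒᵖ E]
    [IsSimpleModule (DualAlgebra K C)ᵐᵒᵖ S] (hS : IsRational (DualAlgebra K C)ᵐᵒᵖ S)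
    (hE : IsRational (DualAlgebra K C)ᵐᵒᵖ E) (i : S →ₗ[(DualAlgebra K C)ᵐᵒᵖ] E)
    (hi : IsEssentialSimple (LinearMap.range i) ⊤)
    (hinj : ∀ (X Y : Type u) [AddCommGroup X] [Module K X] [LeftComodule K C X]
      [AddCommGroup Y] [Module K Y] [LeftComodule K C Y] (ν : X →ₗ[(DualAlgebra K C)ᵐᵒᵖ] Y)
      (f : X →ₗ[(DualAlgebra K C)ᵐᵒᵖ] E), Function.Injective ν →
      ∃ g : Y →ₗ[(DualAlgebra K C)ᵐᵒᵖ] E, ∀ x, g (ν x) = f x) :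
    HasFiniteLoewyLength (DualAlgebra K C)ᵐᵒᵖ E := by
  obtain ⟨hcS, rfl⟩ := isRational_right_exists_comodule hS
  obtain ⟨hcE, rfl⟩ := isRational_right_exists_comodule hE
  refine h S E (i.restrictScalars K) ⟨IsSimpleModule.nontrivial (DualAlgebra K C)ᵐᵒᵖ S,
    fun X hX => ?_⟩ ⟨?_, ?_, ?_, ?_⟩
  · let X' : Submodule (DualAlgebra K C)ᵐᵒᵖ S :=
      { X with smul_mem' := fun f m hm => (isLeftSubcomodule_iff X).1 hX f m hm }
    have hX' : (X' : Set S) = X := rfl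
    rcases eq_bot_or_eq_top X' with h0 | h0
    · left
      apply SetLike.coe_injective
      rw [← hX', h0]
      rfl
    · right
      apply SetLike.coe_injective
      rw [← hX', h0]
      rfl
  · intro X Y _ _ _ _ _ _ ν f hν hνinj hf
    obtain ⟨g, hg⟩ := hinj X Y ⟨ν.toAddHom, (isLeftHom_iff ν).1 hν⟩
      ⟨f.toAddHom, (isLeftHom_iff f).1 hf⟩ hνinj
    exact ⟨g.restrictScalars K, (isLeftHom_iff _).2 fun r m => g.map_smul r m, LinearMap.ext hg⟩
  · exact (isLeftHom_iff _).2 fun r m => i.map_smul r m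
  · rcases LinearMap.injective_or_eq_zero i with h1 | h1
    · exact h1
    · exact absurd (by rw [h1, LinearMap.range_zero]) hi.1
  · intro X hX hX0
    let X' : Submodule (DualAlgebra K C)ᵐᵒᵖ E :=
      { X with smul_mem' := fun f m hm => (isLeftSubcomodule_iff X).1 hX f m hm }
    obtain ⟨x, hx, hx0⟩ := Submodule.exists_mem_ne_zero_of_ne_bot hX0
    have hle : LinearMap.range i ≤ X' := hi.2.2 X' le_top fun h0 =>
      hx0 ((Submodule.eq_bot_iff X').1 h0 x hx)
    obtain ⟨s, hs, hs0⟩ := Submodule.exists_mem_ne_zero_of_ne_bot hi.1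
    exact fun h0 => hs0 ((Submodule.eq_bot_iff _).1 h0 s ⟨hle hs, hs⟩)

/-- The simple subobject of an injective envelope is essential, in terms of modules. -/
theorem IsInjectiveEnvelope.isEssentialSimple {S E : Type u} [AddCommGroup S] [Module K S]
    [LeftComodule K C S] [AddCommGroup E] [Module K E] [LeftComodule K C E] {i : S →ₗ[K] E}
    (hS : IsSimpleLeftComodule K C S) (hi : IsInjectiveEnvelope K C i) :
    ∃ S' : Submodule (DualAlgebra K C)ᵐᵒᵖ E, IsEssentialSimple S' ⊤ := by
  let i' : S →ₗ[(DualAlgebra K C)ᵐᵒᵖ] E := ⟨i.toAddHom, (isLeftHom_iff i).1 hi.2.1⟩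
  have : Nontrivial S := hS.1
  obtain ⟨s₀, hs₀⟩ := exists_ne (0 : S)
  refine ⟨LinearMap.range i', fun h0 => hs₀ (hi.2.2.1 ?_), le_top, fun Y _ hY0 => ?_⟩
  · rw [map_zero]
    exact (Submodule.eq_bot_iff _).1 h0 (i s₀) ⟨s₀, rfl⟩
  · have h1 := hi.2.2.2 (Y.restrictScalars K)
      ((isLeftSubcomodule_iff _).2 fun f m hm => Y.smul_mem f hm)
      (fun h0 => hY0 ((Submodule.restrictScalars_eq_bot_iff K _ _).1 h0))
    obtain ⟨_, ⟨hyY, s, rfl⟩, hs0⟩ := Submodule.exists_mem_ne_zero_of_ne_bot h1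
    have h2 := hS.2 ((Y.comap i').restrictScalars K)
      ((isLeftSubcomodule_iff _).2 fun f m hm => (Y.comap i').smul_mem f hm)
    rcases h2 with h2 | h2
    · exact absurd (by rw [(Submodule.eq_bot_iff _).1 h2 s hyY, map_zero]) hs0
    · rintro _ ⟨s, rfl⟩
      have h3 : s ∈ (Y.comap i').restrictScalars K := h2 ▸ Submodule.mem_top
      exact h3

theorem hasFiniteLoewyLength_of_finite {E : Type*} [AddCommGroup E] [Module K E]
    [Module (DualAlgebra K C)ᵐᵒᵖ E] [IsScalarTower K (DualAlgebra K C)ᵐᵒᵖ E] [Module.Finite K E] :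
    HasFiniteLoewyLength (DualAlgebra K C)ᵐᵒᵖ E := by
  have : IsNoetherian (DualAlgebra K C)ᵐᵒᵖ E := isNoetherian_of_tower K inferInstance
  have : IsArtinian (DualAlgebra K C)ᵐᵒᵖ E := isArtinian_of_tower K inferInstance
  exact hasFiniteLoewyLength_of_finiteLength

/-- The injective hulls of simple right submodules of `C` are finite dimensional. -/
def HullsAreFinite (K C : Type u) [Field K] [AddCommGroup C] [Module K C] [Coalgebra K C] : Prop :=
  ∀ (S E : Submodule (DualAlgebra K C)ᵐᵒᵖ C) (π : C →ₗ[(DualAlgebra K C)ᵐᵒᵖ] E),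
    IsEssentialSimple S E → (∀ e : E, π e = e) → Module.Finite K E

theorem IsEssentialSimple.isAtom {R M : Type*} [Ring R] [AddCommGroup M] [Module R M]
    {S X : Submodule R M} (h : IsEssentialSimple S X) : IsAtom S := by
  refine ⟨h.1, fun Y hY => ?_⟩
  by_contra hY0
  exact absurd (h.2.2 Y (hY.le.trans h.2.1) hY0) (not_le_of_gt hY)

/-- A hull is the injective envelope of its simple submodule in the category of left comodules, so
the hypothesis bounds its Loewy length. -/
theorem RightGeneratingCondition.hullsAreFinite_of_envelopes (hgen : RightGeneratingCondition K C)
    (h : SimpleEnvelopesHaveFiniteLoewyLength K C) : HullsAreFinite K C := by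
  intro S E π hS hπ
  have hrat : IsRational (DualAlgebra K C)ᵐᵒᵖ C := isRational_self
  have hSs : IsSimpleModule (DualAlgebra K C)ᵐᵒᵖ S := isSimpleModule_iff_isAtom.2 hS.isAtom
  have hE0 : E ≠ ⊥ := fun h0 => hS.1 (le_bot_iff.1 (h0 ▸ hS.2.1))
  obtain ⟨n, hn⟩ := h.hasFiniteLoewyLength (hrat.submodule S) (hrat.submodule E)
    (Submodule.inclusion hS.2.1)
    (by rw [Submodule.range_inclusion]; exact hS.comap_subtype le_rfl hE0)
    (fun X Y _ _ _ _ _ _ ν f hν =>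
      IsRational.exists_extension π hπ (isRational_of_leftComodule Y) ν hν f)
  refine hgen.finite_of_pow_smul_eq_zero hS π hπ ⟨n, fun f hf x hx => ?_⟩
  exact congrArg Subtype.val (smul_eq_zero_of_mem_loewySeries_right (hrat.submodule E) n f hf
    ⟨x, hx⟩ (hn ▸ Submodule.mem_top))

theorem RightGeneratingCondition.hullsAreFinite_of_coradicalFiltration
    (hgen : RightGeneratingCondition K C) {n : ℕ} (h : coradicalFiltration K C n = ⊤) :
    HullsAreFinite K C := fun S E π hS hπ =>
  hgen.finite_of_pow_smul_eq_zero hS π hπ ⟨n + 1, fun f hf x _ => by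
    rw [eq_zero_of_mem_pow_of_loewySeries_eq_top h hf, MulOpposite.op_zero]
    exact zero_smul (DualAlgebra K C)ᵐᵒᵖ x⟩

/-- A module with an essential simple submodule that embeds in a direct sum of copies of `C^*` is
finite dimensional, since its dual is a quotient of a cyclic submodule of `C`. -/
theorem IsRightQcF.simpleEnvelopesHaveFiniteLoewyLength (h : IsRightQcF K C) :
    SimpleEnvelopesHaveFiniteLoewyLength K C := by
  intro S E _ _ _ _ _ _ i hS hi
  obtain ⟨S', hS'⟩ := hi.isEssentialSimple hS
  obtain ⟨ι, j, hj⟩ := h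
  have hE : IsRational (DualAlgebra K C)ᵐᵒᵖ E := isRational_of_leftComodule E
  obtain ⟨s, hs, hs0⟩ := Submodule.exists_mem_ne_zero_of_ne_bot hS'.1
  obtain ⟨u, hu⟩ : ∃ u : Module.Dual K E, u s ≠ 0 := by
    by_contra! h
    exact hs0 ((Module.forall_dual_apply_eq_zero_iff K s).1 h)
  obtain ⟨θ, hθ⟩ := hE.exists_coefficient_map u
  have hθs : j (θ s) ≠ 0 := fun h0 => hu (by
    rw [← one_smul (DualAlgebra K C)ᵐᵒᵖ s, ← hθ, hj (h0.trans (map_zero j).symm), map_zero])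
  obtain ⟨a, ha⟩ := Finsupp.ne_iff.1 hθs
  obtain ⟨c, hc⟩ : ∃ c, eval (j (θ s) a) c ≠ 0 := by
    by_contra! h
    exact ha ((eval (K := K) (C := C)).injective (by ext c; rw [h c]; rfl))
  -- the functionals on `E` obtained by evaluating a coordinate of `j ∘ θ` at elements of `C`
  let Λ : C →ₗ[K] Module.Dual K E :=
    LinearMap.flip ((eval (K := K) (C := C) (R := DualAlgebra K C)).toLinearMap ∘ₗ
      (Finsupp.lapply a : (ι →₀ DualAlgebra K C) →ₗ[K] _) ∘ₗ
      (j.restrictScalars K) ∘ₗ θ.restrictScalars K)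
  have hΛ : ∀ d x, Λ d x = eval (j (θ x) a) d := fun d x => rfl
  have hsurj : Function.Surjective
      (Λ ∘ₗ ((Submodule.span (DualAlgebra K C) {c}).restrictScalars K).subtype) := by
    intro v
    obtain ⟨f, hf⟩ := hS'.exists_smul_eq hE (u := Λ c) ⟨s, hs, hc⟩ v
    refine ⟨⟨f • c, Submodule.smul_mem _ f (Submodule.mem_span_singleton_self c)⟩, ?_⟩
    rw [← hf]
    ext x
    rw [leftDual_smul_apply, hΛ, θ.map_smul, j.map_smul]
    exact eval_smul (j (θ x) a) f c
  have hfin : Module.Finite K ((Submodule.span (DualAlgebra K C) {c}).restrictScalars K) :=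
    (isRational_self (R := DualAlgebra K C)).finite_span_singleton c
  have : Module.Finite K E :=
    (Module.finite_dual_iff K).1 (Module.Finite.of_surjective _ hsurj)
  exact hasFiniteLoewyLength_of_finite

/-- Finite dimensional hulls embed in the dual algebra: dualize a surjection from `C`. -/
theorem RightGeneratingCondition.exists_embedding (hgen : RightGeneratingCondition K C)
    {S E : Submodule (DualAlgebra K C)ᵐᵒᵖ C} (hS : IsEssentialSimple S E) [Module.Finite K E] :
    ∃ j : E →ₗ[(DualAlgebra K C)ᵐᵒᵖ] DualAlgebra K C, Function.Injective j := by
  have hE0 : E ≠ ⊥ := fun h0 => hS.1 (le_bot_iff.1 (h0 ▸ hS.2.1))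
  have hS' := hS.comap_subtype le_rfl hE0
  have hE : IsRational (DualAlgebra K C)ᵐᵒᵖ E := isRational_self.submodule E
  obtain ⟨φ, c, hφ⟩ := hgen.exists_hom_dual hE hS'
  let j : E →ₗ[(DualAlgebra K C)ᵐᵒᵖ] DualAlgebra K C :=
    { toFun := fun x => WithConv.toConv ((φ.restrictScalars K).flip x)
      map_add' := fun x y => by rw [map_add, WithConv.toConv_add]
      map_smul' := fun r x => by
        apply (eval (K := K) (C := C)).injective
        ext d
        change φ d (r • x) = eval (WithConv.toConv ((φ.restrictScalars K).flip x) * r.unop) d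
        rw [← eval_smul]
        change _ = φ (r.unop • d) x
        rw [φ.map_smul, leftDual_smul_apply, MulOpposite.op_unop] }
  refine ⟨j, ?_⟩
  rw [← LinearMap.ker_eq_bot, LinearMap.ker_eq_bot']
  intro x hx
  refine (Module.forall_dual_apply_eq_zero_iff K x).1 fun v => ?_
  obtain ⟨f, rfl⟩ := hS'.exists_smul_eq hE hφ v
  rw [← φ.map_smul]
  exact LinearMap.congr_fun (congrArg WithConv.ofConv hx) (f • c)

/-- The sum of two disjoint retracts of `C` is a retract. -/
theorem exists_retract_sup {E F : Submodule (DualAlgebra K C)ᵐᵒᵖ C} (hEF : Disjoint E F)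
    (hE : ∃ π : C →ₗ[(DualAlgebra K C)ᵐᵒᵖ] E, ∀ e : E, π e = e)
    (hF : ∃ π : C →ₗ[(DualAlgebra K C)ᵐᵒᵖ] F, ∀ e : F, π e = e) :
    ∃ π : C →ₗ[(DualAlgebra K C)ᵐᵒᵖ] ↥(E ⊔ F), ∀ e : ↥(E ⊔ F), π e = e := by
  obtain ⟨p, hp⟩ := hE
  obtain ⟨q, hq⟩ := hF
  -- `1 - p` is injective on `F`, so that some `h` inverts it there
  let d : C →ₗ[(DualAlgebra K C)ᵐᵒᵖ] C := LinearMap.id - E.subtype ∘ₗ p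
  have hd : ∀ x, d x = x - p x := fun x => rfl
  obtain ⟨h, hh⟩ := IsRational.exists_extension q hq
    (isRational_self (R := (DualAlgebra K C)ᵐᵒᵖ)) (d ∘ₗ F.subtype) (by
      rw [← LinearMap.ker_eq_bot, LinearMap.ker_eq_bot']
      intro x hx
      rw [LinearMap.comp_apply, hd, sub_eq_zero] at hx
      refine Subtype.ext (Submodule.disjoint_def.1 hEF x ?_ x.2)
      exact (show (x : C) = _ from hx) ▸ (p x).2) LinearMap.id
  let r : C →ₗ[(DualAlgebra K C)ᵐᵒᵖ] C := E.subtype ∘ₗ p + d ∘ₗ F.subtype ∘ₗ h ∘ₗ d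
  have hr : ∀ x, r x = p x + (h (d x) - p (h (d x))) := fun x => rfl
  refine ⟨r.codRestrict (E ⊔ F) fun x => ?_, ?_⟩
  · rw [hr]
    exact add_mem (Submodule.mem_sup_left (p x).2) (sub_mem (Submodule.mem_sup_right (h (d x)).2)
      (Submodule.mem_sup_left (p _).2))
  · rintro ⟨x, hx⟩
    refine Subtype.ext ?_
    obtain ⟨e, he, f, hf, rfl⟩ := Submodule.mem_sup.1 hx
    have h1 : (p e : C) = e := congrArg Subtype.val (hp ⟨e, he⟩)
    have h2 : d e = 0 := by rw [hd, h1, sub_self]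
    have h3 : h (d f) = ⟨f, hf⟩ := hh ⟨f, hf⟩
    change r (e + f) = e + f
    rw [hr, map_add d, h2, zero_add, h3, map_add, Submodule.coe_add, h1]
    change e + (p f : C) + (f - p f) = e + f
    abel

theorem sSupIndep_insert {α : Type*} [CompleteLattice α] [IsModularLattice α] {s : Set α}
    (hs : sSupIndep s) {a : α} (ha : Disjoint a (sSup s)) : sSupIndep (insert a s) := by
  intro x hx
  by_cases hxa : x = a
  · subst hxa
    refine ha.mono_right (sSup_le_sSup ?_)
    rintro y ⟨hy, hyx⟩
    exact hy.resolve_left hyx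
  · have hxs : x ∈ s := hx.resolve_left hxa
    have h1 : sSup (insert a s \ {x}) ≤ sSup (s \ {x}) ⊔ a := by
      refine sSup_le ?_
      rintro y ⟨rfl | hy, hyx⟩
      · exact le_sup_right
      · exact (le_sSup (show y ∈ s \ {x} from ⟨hy, hyx⟩)).trans le_sup_left
    refine Disjoint.mono_right h1 ?_
    refine (hs hxs).disjoint_sup_right_of_disjoint_sup_left (ha.symm.mono_left ?_)
    exact sup_le (le_sSup hxs) (sSup_le_sSup Set.sdiff_subset)

theorem exists_retract_finset_sup {s : Set (Submodule (DualAlgebra K C)ᵐᵒᵖ C)} (hs : sSupIndep s)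
    (h : ∀ E ∈ s, ∃ π : C →ₗ[(DualAlgebra K C)ᵐᵒᵖ] E, ∀ e : E, π e = e)
    (t : Finset (Submodule (DualAlgebra K C)ᵐᵒᵖ C)) (ht : (t : Set _) ⊆ s) :
    ∃ π : C →ₗ[(DualAlgebra K C)ᵐᵒᵖ] ↥(t.sup id), ∀ e : ↥(t.sup id), π e = e := by
  classical
  induction t using Finset.induction with
  | empty =>
    refine ⟨0, fun e => Subtype.ext ?_⟩
    have h0 : (e : C) ∈ (⊥ : Submodule (DualAlgebra K C)ᵐᵒᵖ C) := by
      simpa only [Finset.sup_empty] using e.2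
    exact ((Submodule.mem_bot _).1 h0).symm
  | insert E t hE ih =>
    rw [Finset.sup_insert]
    rw [Finset.coe_insert] at ht
    refine exists_retract_sup ?_ (h E (ht (Set.mem_insert _ _)))
      (ih ((Set.subset_insert _ _).trans ht))
    rw [Finset.sup_id_eq_sSup]
    exact hs.disjoint_sSup (ht (Set.mem_insert _ _)) ((Set.subset_insert _ _).trans ht)
      (by exact_mod_cast hE)

end Envelope

/-! ### Decomposition of the coalgebra into hulls -/

section Decomposition

/-- Nonzero rational modules have simple submodules, by the finiteness theorem. -/
theorem IsRational.exists_isAtom_le {K C R M : Type*} [Field K] [AddCommGroup C] [Module K C]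
    [Ring R] [Algebra K R] [Module R C] [DualAction K C R] [AddCommGroup M] [Module R M]
    [Module K M] [IsScalarTower K R M] (hM : IsRational R M) {X : Submodule R M} (hX : X ≠ ⊥) :
    ∃ T ≤ X, IsAtom T := by
  obtain ⟨x, hx, hx0⟩ := Submodule.exists_mem_ne_zero_of_ne_bot hX
  let Y : Submodule R M := Submodule.span R {x}
  have hYX : Y ≤ X := (Submodule.span_singleton_le_iff_mem _ _).2 hx
  have hY : Module.Finite K Y := hM.finite_span_singleton x
  have : IsArtinian R Y := isArtinian_of_tower K inferInstance
  have hY0 : (⊤ : Submodule R Y) ≠ ⊥ := fun h => hx0 (congrArg Subtype.val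
    ((Submodule.eq_bot_iff _).1 h ⟨x, Submodule.mem_span_singleton_self x⟩ Submodule.mem_top))
  obtain ⟨T, hT, -⟩ := (eq_bot_or_exists_atom_le (⊤ : Submodule R Y)).resolve_left hY0
  refine ⟨T.map Y.subtype, (Submodule.map_subtype_le _ _).trans hYX, ?_⟩
  have hTs : IsSimpleModule R T := isSimpleModule_iff_isAtom.2 hT
  exact isSimpleModule_iff_isAtom.1 ((Submodule.equivMapOfInjective Y.subtype
    Y.injective_subtype T).isSimpleModule_iff.1 hTs)

variable {K C : Type u} [Field K] [AddCommGroup C] [Module K C] [Coalgebra K C]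

/-- A maximal independent family of finite dimensional hulls embedded in `C^*` has sum `C`:
otherwise, as finite sums of hulls are retracts of `C`, some simple submodule is disjoint from
the sum of the family, and its hull enlarges the family. -/
theorem RightGeneratingCondition.isRightQcF (hgen : RightGeneratingCondition K C)
    (h : HullsAreFinite K C) : IsRightQcF K C := by
  classical
  let Q : Submodule (DualAlgebra K C)ᵐᵒᵖ C → Prop := fun E =>
    (∃ π : C →ₗ[(DualAlgebra K C)ᵐᵒᵖ] E, ∀ e : E, π e = e) ∧
      ∃ j : E →ₗ[(DualAlgebra K C)ᵐᵒᵖ] DualAlgebra K C, Function.Injective j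
  obtain ⟨s, ⟨hs, hsQ⟩, hmax⟩ := zorn_subset
    {s : Set (Submodule (DualAlgebra K C)ᵐᵒᵖ C) | sSupIndep s ∧ ∀ E ∈ s, Q E} fun c hc hchain =>
      ⟨⋃₀ c, ⟨iSupIndep_sUnion_of_directed hchain.directedOn fun s hs => (hc hs).1,
        fun E ⟨s, hsc, hE⟩ => (hc hsc).2 E hE⟩, fun _ => Set.subset_sUnion_of_mem⟩
  have hrat : IsRational (DualAlgebra K C)ᵐᵒᵖ C := isRational_self
  have htop : sSup s = ⊤ := by
    by_contra hW
    have hnt : Nontrivial (C ⧸ sSup s) := Submodule.Quotient.nontrivial_iff.2 hW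
    obtain ⟨T, -, hT⟩ := (hrat.quotient (sSup s)).exists_isAtom_le (K := K) (X := ⊤) top_ne_bot
    obtain ⟨t, htT, ht0⟩ := Submodule.exists_mem_ne_zero_of_ne_bot hT.1
    obtain ⟨c, rfl⟩ := Submodule.Quotient.mk_surjective _ t
    -- a retraction onto a finite sum of members of `s` containing the part of `c C^*` in `sSup s`
    let B := Submodule.span (DualAlgebra K C)ᵐᵒᵖ {c} ⊓ sSup s
    have hBfg : B.FG := by
      have h1 : Module.Finite K
          ((Submodule.span (DualAlgebra K C)ᵐᵒᵖ {c}).restrictScalars K) :=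
        hrat.finite_span_singleton c
      have h2 : Module.Finite K (B.restrictScalars K) :=
        Submodule.finiteDimensional_of_le (S₂ := (Submodule.span (DualAlgebra K C)ᵐᵒᵖ
          {c}).restrictScalars K) (fun x hx => hx.1)
      have h3 : Module.Finite K B := h2
      exact Module.Finite.iff_fg.1 (Module.Finite.of_restrictScalars_finite K _ B)
    obtain ⟨F, hFs, hBF⟩ :=
      (CompleteLattice.isCompactElement_iff_exists_le_sSup_of_le_sSup _ B).1
        ((Submodule.fg_iff_compact B).1 hBfg) s inf_le_right
    obtain ⟨π, hπ⟩ := exists_retract_finset_sup hs (fun E hE => (hsQ E hE).1) F hFs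
    have hπs : ∀ x, (π x : C) ∈ sSup s := fun x =>
      Finset.sup_le (f := id) (fun E hE => le_sSup (hFs hE)) (π x).2
    let c' : C := c - π c
    have hc' : (Submodule.Quotient.mk c' : C ⧸ sSup s) = Submodule.Quotient.mk c := by
      rw [Submodule.Quotient.eq]
      have : c' - c = -(π c : C) := by simp [c']
      rw [this]
      exact neg_mem (hπs c)
    have hkey : ∀ r : (DualAlgebra K C)ᵐᵒᵖ, r • c' ∈ sSup s → r • c' = 0 := by
      intro r hr
      have h1 : r • c' = r • c - π (r • c) := by
        rw [smul_sub, π.map_smul, Submodule.coe_smul]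
      have h2 : r • c ∈ B := by
        refine ⟨Submodule.smul_mem _ r (Submodule.mem_span_singleton_self c), ?_⟩
        have h3 : r • c = r • c' + π (r • c) := by rw [h1, sub_add_cancel]
        rw [h3]
        exact add_mem hr (hπs _)
      rw [h1, sub_eq_zero]
      exact (congrArg Subtype.val (hπ ⟨r • c, hBF h2⟩)).symm
    have hc's : c' ∉ sSup s := fun hmem => ht0 (by
      rw [← hc']
      exact (Submodule.Quotient.mk_eq_zero _).2 hmem)
    let S := Submodule.span (DualAlgebra K C)ᵐᵒᵖ {c'}
    have hSs : ∀ x ∈ S, x ∈ sSup s → x = 0 := by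
      intro x hx hxs
      obtain ⟨r, rfl⟩ := Submodule.mem_span_singleton.1 hx
      exact hkey r hxs
    have hcS : c' ∈ S := Submodule.mem_span_singleton_self c'
    have hS : IsAtom S := by
      refine ⟨fun h0 => hc's ?_, fun Y hY => ?_⟩
      · rw [(Submodule.eq_bot_iff _).1 h0 c' hcS]
        exact Submodule.zero_mem _
      · by_contra hY0
        obtain ⟨y, hy, hy0⟩ := Submodule.exists_mem_ne_zero_of_ne_bot hY0
        have h1 : Y.map (sSup s).mkQ ≤ T := by
          rintro _ ⟨z, hz, rfl⟩
          obtain ⟨r, rfl⟩ := Submodule.mem_span_singleton.1 (hY.le hz)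
          rw [Submodule.mkQ_apply, Submodule.Quotient.mk_smul, hc']
          exact T.smul_mem r htT
        have h2 : Y.map (sSup s).mkQ ≠ ⊥ := fun h0 => hy0 (hSs y (hY.le hy)
          ((Submodule.Quotient.mk_eq_zero _).1
            ((Submodule.eq_bot_iff _).1 h0 _ (Submodule.mem_map_of_mem hy))))
        have h3 := (hT.le_iff.1 h1).resolve_left h2
        obtain ⟨z, hz, hzt⟩ : Submodule.Quotient.mk c ∈ Y.map (sSup s).mkQ := h3 ▸ htT
        have h4 : z - c' = 0 := hSs _ (sub_mem (hY.le hz) hcS) (by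
          rw [← Submodule.Quotient.mk_eq_zero, Submodule.Quotient.mk_sub, hc', ← hzt]
          exact sub_self _)
        refine hY.not_ge ((Submodule.span_singleton_le_iff_mem _ _).2 ?_)
        rwa [← sub_eq_zero.1 h4]
    obtain ⟨E, p, hSE, hp⟩ := exists_retract_of_isAtom hS
    have hEs : Disjoint E (sSup s) := by
      rw [disjoint_iff]
      by_contra hne
      exact hc's ((hSE.2.2 _ inf_le_left hne).trans inf_le_right hcS)
    have hfin : Module.Finite K E := h S E p hSE hp
    have hEmem : E ∈ s := hmax ⟨sSupIndep_insert hs hEs, by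
      rintro F (rfl | hF)
      · exact ⟨⟨p, hp⟩, hgen.exists_embedding hSE⟩
      · exact hsQ F hF⟩ (Set.subset_insert E s) (Set.mem_insert E s)
    exact hc's (le_sSup hEmem (hSE.2.1 hcS))
  choose j hj using fun E : s => (hsQ E E.2).2
  let e := ((sSupIndep_iff s).1 hs).linearEquiv (by rw [← sSup_eq_iSup', htop])
  refine ⟨s, (finsuppLequivDFinsupp (DualAlgebra K C)ᵐᵒᵖ).symm.toLinearMap ∘ₗ
    DFinsupp.mapRange.linearMap j ∘ₗ e.symm.toLinearMap, ?_⟩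
  intro x y hxy
  exact e.symm.injective ((DFinsupp.mapRange_injective _ fun E => map_zero (j E)).2 hj
    ((finsuppLequivDFinsupp (DualAlgebra K C)ᵐᵒᵖ).symm.injective hxy))

end Decomposition

/-! ### Projective covers -/

section ProjectiveCover

/-- A projective module of finite length mapping onto `M` has a direct summand that is minimal
among the submodules mapping onto `M`. -/
theorem exists_summand_isProjectiveCover {R P M : Type*} [Ring R] [AddCommGroup P] [Module R P]
    [AddCommGroup M] [Module R M] [IsNoetherian R P] [IsArtinian R P] [Module.Projective R P]
    (p : P →ₗ[R] M) (hp : Function.Surjective p) :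
    ∃ Y : Submodule R P, Module.Projective R Y ∧ Y.map p = ⊤ ∧
      ∀ X ≤ Y, X.map p = ⊤ → X = Y := by
  obtain ⟨Y, ⟨⟨Z, hYZ⟩, hY⟩, hmin⟩ := exists_minimal_of_wellFoundedLT
    (fun Y : Submodule R P => (∃ Z, IsCompl Y Z) ∧ Y.map p = ⊤)
    ⟨⊤, ⟨⊥, isCompl_top_bot⟩, by rw [Submodule.map_top, LinearMap.range_eq_top.2 hp]⟩
  have hproj : Module.Projective R Y := Module.Projective.of_split Y.subtype
    (Submodule.projectionOnto Y Z hYZ)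
    (LinearMap.ext fun y => Submodule.projectionOnto_apply_left hYZ y)
  refine ⟨Y, hproj, hY, fun X hXY hX => le_antisymm hXY ?_⟩
  obtain ⟨g, hg⟩ := Module.projective_lifting_property (p ∘ₗ X.subtype) (p ∘ₗ Y.subtype) (by
    rw [← LinearMap.range_eq_top, LinearMap.range_comp, Submodule.range_subtype, hX])
  let a : Module.End R Y := Submodule.inclusion hXY ∘ₗ g
  have ha : ∀ y : Y, p (a y) = p y := fun y => LinearMap.congr_fun hg y
  have hak : ∀ (k : ℕ) (y : Y), p ((a ^ k) y) = p y := fun k y => by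
    induction k with
    | zero => rfl
    | succ k ih => rw [pow_succ', Module.End.mul_apply, ha, ih]
  -- Fitting's lemma: the range of a power of `a` is a summand mapping onto `M`
  obtain ⟨k, hk, hk1⟩ := (a.eventually_isCompl_ker_pow_range_pow.and
    (Filter.eventually_ge_atTop 1)).exists
  have hle : Y ≤ (LinearMap.range (a ^ k)).map Y.subtype := by
    refine hmin ⟨exists_isCompl_map_subtype hYZ hk.symm, ?_⟩ (Submodule.map_subtype_le _ _)
    rw [Submodule.eq_top_iff']
    intro m
    obtain ⟨y, hy, rfl⟩ : m ∈ Y.map p := hY ▸ Submodule.mem_top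
    exact ⟨_, ⟨_, ⟨⟨y, hy⟩, rfl⟩, rfl⟩, hak k ⟨y, hy⟩⟩
  intro y hy
  obtain ⟨_, ⟨z, rfl⟩, rfl⟩ := hle hy
  rw [← Nat.sub_add_cancel hk1, pow_succ', Module.End.mul_apply]
  exact (g _).2

variable {K C : Type u} [Field K] [AddCommGroup C] [Module K C] [Coalgebra K C]

/-- The inclusion of the dual of a retract of `C` in `C^*`. -/
noncomputable def dualRetract {E : Submodule (DualAlgebra K C)ᵐᵒᵖ C}
    (π : C →ₗ[(DualAlgebra K C)ᵐᵒᵖ] E) :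
    Module.Dual K E →ₗ[DualAlgebra K C] DualAlgebra K C where
  toFun v := WithConv.toConv (v ∘ₗ π.restrictScalars K)
  map_add' v w := rfl
  map_smul' f v := by
    apply (eval (K := K) (C := C)).injective
    ext c
    change (f • v) (π c) = eval (f * WithConv.toConv (v ∘ₗ π.restrictScalars K)) c
    rw [leftDual_smul_apply, ← π.map_smul]
    exact eval_smul (MulOpposite.op (WithConv.toConv (v ∘ₗ π.restrictScalars K)))
      (MulOpposite.op f) c

theorem eval_dualRetract {E : Submodule (DualAlgebra K C)ᵐᵒᵖ C}
    (π : C →ₗ[(DualAlgebra K C)ᵐᵒᵖ] E) (v : Module.Dual K E) (c : C) :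
    eval (dualRetract π v) c = v (π c) := rfl

/-- The dual of a retract of `C` is a direct summand of `C^*`, the retraction being restriction of
functionals. -/
theorem projective_dual_of_retract {E : Submodule (DualAlgebra K C)ᵐᵒᵖ C}
    (π : C →ₗ[(DualAlgebra K C)ᵐᵒᵖ] E) (hπ : ∀ e : E, π e = e) :
    Module.Projective (DualAlgebra K C) (Module.Dual K E) := by
  let s : DualAlgebra K C →ₗ[DualAlgebra K C] Module.Dual K E :=
    { toFun := fun f => eval f ∘ₗ E.subtype.restrictScalars K
      map_add' := fun f g => by rw [map_add, LinearMap.add_comp]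
      map_smul' := fun f g => LinearMap.ext fun e =>
        (eval_smul (MulOpposite.op g) (MulOpposite.op f) (e : C)).symm }
  exact Module.Projective.of_split (dualRetract π) s (LinearMap.ext fun v => LinearMap.ext fun e =>
    congrArg v (hπ e))

/-- Every nonzero rational left module receives a nonzero morphism from the dual of the injective
hull of a simple right submodule of `C`. -/
theorem IsRational.exists_hull_dual_hom {M : Type*} [AddCommGroup M] [Module K M]
    [Module (DualAlgebra K C) M] [IsScalarTower K (DualAlgebra K C) M]
    (hM : IsRational (DualAlgebra K C) M) {q : M} (hq : q ≠ 0) :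
    ∃ (S E : Submodule (DualAlgebra K C)ᵐᵒᵖ C) (π : C →ₗ[(DualAlgebra K C)ᵐᵒᵖ] E)
      (φ : Module.Dual K E →ₗ[DualAlgebra K C] M),
      IsEssentialSimple S E ∧ (∀ e : E, π e = e) ∧ φ ≠ 0 := by
  obtain ⟨w, hw⟩ : ∃ w : Module.Dual K M, w q ≠ 0 := by
    by_contra! h
    exact hq ((Module.forall_dual_apply_eq_zero_iff K q).1 h)
  obtain ⟨θ, hθ⟩ := hM.exists_coefficient_map w
  have hc : θ q ≠ 0 := fun h => hw (by
    rw [← one_smul (DualAlgebra K C) q, ← hθ, h, map_zero])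
  obtain ⟨S, hS, hSa⟩ := (isRational_self (R := (DualAlgebra K C)ᵐᵒᵖ)).exists_isAtom_le (K := K)
    (X := Submodule.span (DualAlgebra K C)ᵐᵒᵖ {θ q}) (by simpa using hc)
  obtain ⟨E, π, hSE, hπ⟩ := exists_retract_of_isAtom hSa
  obtain ⟨s, hs, hs0⟩ := Submodule.exists_mem_ne_zero_of_ne_bot hSa.1
  obtain ⟨g, rfl⟩ := Submodule.mem_span_singleton.1 (hS hs)
  refine ⟨S, E, π, (LinearMap.toSpanSingleton (DualAlgebra K C) M q) ∘ₗ dualRetract π, hSE, hπ,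
    fun h0 => hs0 ?_⟩
  have h1 : ∀ v : Module.Dual K E, v (π (g • θ q)) = 0 := fun v => by
    have h2 : dualRetract π v • q = 0 := LinearMap.congr_fun h0 v
    rw [← eval_dualRetract, ← MulOpposite.op_unop g, ← eval_left_smul, ← θ.map_smul, h2, map_zero,
      map_zero]
  have h3 := (Module.forall_dual_apply_eq_zero_iff K _).1 h1
  exact (congrArg Subtype.val (hπ ⟨_, hSE.2.1 hs⟩)).symm.trans (congrArg Subtype.val h3)

/-- If hulls are finite dimensional then every finite dimensional rational left module is a quotient
of a finite dimensional projective one. The induction on the dimension takes the image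
`X` of the dual of a hull, and lifts to `M` a morphism from a projective module onto `M ⧸ X`. -/
theorem HullsAreFinite.exists_projective (h : HullsAreFinite K C) (n : ℕ) :
    ∀ (M : Type u) [AddCommGroup M] [Module K M] [Module (DualAlgebra K C) M]
      [IsScalarTower K (DualAlgebra K C) M] [Module.Finite K M],
      IsRational (DualAlgebra K C) M → Module.finrank K M ≤ n →
      ∃ (P : Type u) (_ : AddCommGroup P) (_ : Module K P) (_ : Module (DualAlgebra K C) P)
        (_ : IsScalarTower K (DualAlgebra K C) P) (p : P →ₗ[DualAlgebra K C] M),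
        Module.Finite K P ∧ IsRational (DualAlgebra K C) P ∧
        Module.Projective (DualAlgebra K C) P ∧ Function.Surjective p := by
  induction n with
  | zero =>
    intro M _ _ _ _ _ hM hn
    have : Subsingleton M := Module.finrank_zero_iff.1 (Nat.le_zero.1 hn)
    have : Module.Projective (DualAlgebra K C) M :=
      Module.Projective.of_split (M := DualAlgebra K C) 0 0
        (LinearMap.ext fun x => Subsingleton.elim _ _)
    exact ⟨M, inferInstance, inferInstance, inferInstance, inferInstance, LinearMap.id,
      inferInstance, hM, inferInstance, Function.surjective_id⟩
  | succ n ih =>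
    intro M _ _ _ _ _ hM hn
    by_cases hM0 : ∃ q : M, q ≠ 0
    swap
    · push Not at hM0
      have : Subsingleton M := ⟨fun x y => (hM0 x).trans (hM0 y).symm⟩
      exact ih M hM (by rw [Module.finrank_zero_of_subsingleton]; exact n.zero_le)
    obtain ⟨q, hq⟩ := hM0
    obtain ⟨S, E, π, φ, hSE, hπ, hφ⟩ := hM.exists_hull_dual_hom hq
    have hE : Module.Finite K E := h S E π hSE hπ
    have hErat : IsRational (DualAlgebra K C)ᵐᵒᵖ E := isRational_self.submodule E
    have hEproj := projective_dual_of_retract π hπ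
    let X := LinearMap.range φ
    have hX : X.restrictScalars K ≠ ⊥ := fun h0 => hφ (LinearMap.range_eq_bot.1
      ((Submodule.restrictScalars_eq_bot_iff K _ _).1 h0))
    have hlt : Module.finrank K (M ⧸ X) ≤ n := by
      have h1 : Module.finrank K (M ⧸ X.restrictScalars K) +
        Module.finrank K (X.restrictScalars K) = Module.finrank K M :=
        Submodule.finrank_quotient_add_finrank _
      have h2 : 0 < Module.finrank K (X.restrictScalars K) := by
        rw [Module.finrank_pos_iff]
        exact Submodule.nontrivial_iff_ne_bot.2 hX
      have h3 : Module.finrank K (M ⧸ X) = Module.finrank K (M ⧸ X.restrictScalars K) := rfl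
      omega
    have hfin : Module.Finite K (M ⧸ X) :=
      Module.Finite.of_surjective (X.mkQ.restrictScalars K) (Submodule.mkQ_surjective X)
    obtain ⟨P, _, _, _, _, p, _, hP, _, hp⟩ := ih (M ⧸ X) (hM.quotient X) hlt
    obtain ⟨p', hp'⟩ := Module.projective_lifting_property X.mkQ p X.mkQ_surjective
    refine ⟨Module.Dual K E × P, inferInstance, inferInstance, inferInstance, inferInstance,
      φ.coprod p', inferInstance, hErat.leftDual.prod hP, inferInstance, fun m => ?_⟩
    obtain ⟨y, hy⟩ := hp (X.mkQ m)
    have hmem : m - p' y ∈ X := by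
      rw [← Submodule.Quotient.mk_eq_zero, Submodule.Quotient.mk_sub, sub_eq_zero]
      exact hy.symm.trans (LinearMap.congr_fun hp' y).symm
    obtain ⟨v, hv⟩ := hmem
    exact ⟨(v, y), by rw [LinearMap.coprod_apply, hv, sub_add_cancel]⟩

/-- A projective cover of modules is one of comodules. -/
theorem exists_isProjectiveCover {P M : Type u} [AddCommGroup P] [Module K P]
    [inst : Module (DualAlgebra K C) P] [IsScalarTower K (DualAlgebra K C) P]
    [Module.Projective (DualAlgebra K C) P] [AddCommGroup M] [Module K M] [RightComodule K C M]
    (hP : IsRational (DualAlgebra K C) P) (p : P →ₗ[DualAlgebra K C] M)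
    (hp : Function.Surjective p)
    (hsup : ∀ X : Submodule (DualAlgebra K C) P, X.map p = ⊤ → X = ⊤) :
    ∃ (_ : RightComodule K C P) (p : P →ₗ[K] M), IsProjectiveCover K C p := by
  obtain ⟨hc, rfl⟩ := isRational_left_exists_comodule hP
  refine ⟨hc, p.restrictScalars K, ?_, (isRightHom_iff _).2 fun f m => p.map_smul f m, hp, ?_⟩
  · intro X Y _ _ _ _ _ _ q f hq hqs hf
    obtain ⟨g, hg⟩ := Module.projective_lifting_property
      (⟨q.toAddHom, (isRightHom_iff q).1 hq⟩ : X →ₗ[DualAlgebra K C] Y)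
      (⟨f.toAddHom, (isRightHom_iff f).1 hf⟩ : P →ₗ[DualAlgebra K C] Y) hqs
    exact ⟨g.restrictScalars K, (isRightHom_iff _).2 fun r m => g.map_smul r m,
      LinearMap.ext fun x => LinearMap.congr_fun hg x⟩
  · intro X hX hXtop
    let X' : Submodule (DualAlgebra K C) P :=
      { X with smul_mem' := fun f m hm => (isRightSubcomodule_iff X).1 hX f m hm }
    have h1 : X' = ⊤ := hsup X' (by
      rw [Submodule.eq_top_iff']
      intro m
      obtain ⟨x, rfl⟩ := hp m
      obtain ⟨y, hy, z, hz, rfl⟩ := Submodule.mem_sup.1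
        (show x ∈ X ⊔ LinearMap.ker (p.restrictScalars K) from hXtop ▸ Submodule.mem_top)
      refine ⟨y, hy, ?_⟩
      rw [p.map_add, show p z = 0 from hz, add_zero])
    rw [Submodule.eq_top_iff']
    intro x
    exact (h1 ▸ Submodule.mem_top : x ∈ X')

theorem HullsAreFinite.isRightSemiperfect (h : HullsAreFinite K C) : IsRightSemiperfect K C := by
  intro M _ _ _ hfin
  obtain ⟨P, _, _, _, _, p, _, hP, _, hp⟩ :=
    h.exists_projective _ M (isRational_of_rightComodule M) le_rfl
  have : IsNoetherian (DualAlgebra K C) P := isNoetherian_of_tower K inferInstance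
  have : IsArtinian (DualAlgebra K C) P := isArtinian_of_tower K inferInstance
  obtain ⟨Y, hYproj, hY, hmin⟩ := exists_summand_isProjectiveCover p hp
  obtain ⟨hc, p', hp'⟩ := exists_isProjectiveCover (hP.submodule Y) (p ∘ₗ Y.subtype)
    (by rw [← LinearMap.range_eq_top, LinearMap.range_comp, Submodule.range_subtype, hY])
    (fun X hX => by
      rw [Submodule.map_comp] at hX
      have h1 := hmin _ (Submodule.map_subtype_le _ _) hX
      rw [Submodule.eq_top_iff']
      intro y
      obtain ⟨x, hx, hxy⟩ := h1.ge y.2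
      rwa [← Subtype.ext hxy])
  exact ⟨Y, inferInstance, inferInstance, hc, p', hp'⟩

/-- Right semiperfectness in terms of rational modules. -/
theorem IsRightSemiperfect.exists_cover (h : IsRightSemiperfect K C) {M : Type u} [AddCommGroup M]
    [Module K M] [inst : Module (DualAlgebra K C) M] [IsScalarTower K (DualAlgebra K C) M]
    [Module.Finite K M] (hM : IsRational (DualAlgebra K C) M) :
    ∃ (P : Type u) (_ : AddCommGroup P) (_ : Module K P) (_ : Module (DualAlgebra K C) P)
      (_ : IsScalarTower K (DualAlgebra K C) P) (p : P →ₗ[DualAlgebra K C] M),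
      IsRational (DualAlgebra K C) P ∧ Function.Surjective p ∧
      (∀ X : Submodule (DualAlgebra K C) P, X ⊔ LinearMap.ker p = ⊤ → X = ⊤) ∧
      ∀ (X Y : Type u) [AddCommGroup X] [Module K X] [Module (DualAlgebra K C) X]
        [IsScalarTower K (DualAlgebra K C) X] [AddCommGroup Y] [Module K Y]
        [Module (DualAlgebra K C) Y] [IsScalarTower K (DualAlgebra K C) Y],
        IsRational (DualAlgebra K C) X → IsRational (DualAlgebra K C) Y →
        ∀ (q : X →ₗ[DualAlgebra K C] Y) (f : P →ₗ[DualAlgebra K C] Y), Function.Surjective q →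
          ∃ g : P →ₗ[DualAlgebra K C] X, ∀ x, q (g x) = f x := by
  obtain ⟨hcM, rfl⟩ := isRational_left_exists_comodule hM
  obtain ⟨P, _, _, _, p, hP, hphom, hp, hsup⟩ := h M inferInstance
  refine ⟨P, inferInstance, inferInstance, inferInstance, inferInstance,
    ⟨p.toAddHom, (isRightHom_iff p).1 hphom⟩, isRational_of_rightComodule P, hp, ?_, ?_⟩
  · intro X hX
    have h1 := hsup (X.restrictScalars K)
      ((isRightSubcomodule_iff _).2 fun f m hm => X.smul_mem f hm) (by
        rw [Submodule.eq_top_iff']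
        intro x
        obtain ⟨y, hy, z, hz, rfl⟩ := Submodule.mem_sup.1 (hX ▸ Submodule.mem_top : x ∈ X ⊔ _)
        exact Submodule.add_mem_sup hy hz)
    exact (Submodule.restrictScalars_eq_top_iff K _ _).1 h1
  · intro X Y _ _ instX _ _ _ instY _ hX hY q f hq
    obtain ⟨hcX, rfl⟩ := isRational_left_exists_comodule hX
    obtain ⟨hcY, rfl⟩ := isRational_left_exists_comodule hY
    obtain ⟨g, hg, hqg⟩ := hP X Y (q.restrictScalars K) (f.restrictScalars K)
      ((isRightHom_iff _).2 fun r m => q.map_smul r m) hq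
      ((isRightHom_iff _).2 fun r m => f.map_smul r m)
    exact ⟨⟨g.toAddHom, (isRightHom_iff g).1 hg⟩, fun x => LinearMap.congr_fun hqg x⟩

/-- The projective cover `P` of the dual of a simple left comodule maps onto the dual of every
finite dimensional subcomodule of its injective envelope, so that `dim P` bounds the dimension
of the envelope. -/
theorem IsRightSemiperfect.simpleEnvelopesHaveFiniteLoewyLength (h : IsRightSemiperfect K C) :
    SimpleEnvelopesHaveFiniteLoewyLength K C := by
  intro S₀ E _ _ _ _ _ _ i hS₀ hi
  obtain ⟨S, hS⟩ := hi.isEssentialSimple hS₀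
  have hE : IsRational (DualAlgebra K C)ᵐᵒᵖ E := isRational_of_leftComodule E
  have hSs : IsSimpleModule (DualAlgebra K C)ᵐᵒᵖ S := isSimpleModule_iff_isAtom.2 hS.isAtom
  have hSrat : IsRational (DualAlgebra K C)ᵐᵒᵖ S := hE.submodule S
  have hSfin : Module.Finite K S := by
    obtain ⟨s, hs, hs0⟩ := Submodule.exists_mem_ne_zero_of_ne_bot hS.1
    have h1 : Submodule.span (DualAlgebra K C)ᵐᵒᵖ {s} = S :=
      le_antisymm ((Submodule.span_singleton_le_iff_mem _ _).2 hs)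
        (hS.2.2 _ le_top (by simpa using hs0))
    exact h1 ▸ hE.finite_span_singleton (K := K) s
  obtain ⟨P, _, _, _, _, p, hP, hp, hsup, hlift⟩ := h.exists_cover hSrat.leftDual
  have hds : IsSimpleModule (DualAlgebra K C) (Module.Dual K S) := isSimpleModule_leftDual hSrat
  have := IsSimpleModule.nontrivial (DualAlgebra K C) (Module.Dual K S)
  obtain ⟨u, hu⟩ := exists_ne (0 : Module.Dual K S)
  obtain ⟨x, rfl⟩ := hp u
  obtain ⟨s, hs⟩ : ∃ s, p x s ≠ 0 := by
    by_contra! h0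
    exact hu (LinearMap.ext h0)
  -- `P` is generated by `x`, its kernel being superfluous
  have hx : Submodule.span (DualAlgebra K C) {x} = ⊤ := by
    refine hsup _ ((LinearMap.map_eq_top_iff (LinearMap.range_eq_top.2 hp)).1 ?_)
    refine (eq_bot_or_eq_top _).resolve_left fun h0 => hu ?_
    exact (Submodule.eq_bot_iff _).1 h0 _
      (Submodule.mem_map_of_mem (Submodule.mem_span_singleton_self x))
  have hPfin : Module.Finite K P := by
    have h1 : Module.Finite K (Submodule.span (DualAlgebra K C) {x}) :=
      hP.finite_span_singleton x
    rw [hx] at h1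
    exact Module.Finite.of_surjective
      ((⊤ : Submodule (DualAlgebra K C) P).subtype.restrictScalars K) fun y => ⟨⟨y, trivial⟩, rfl⟩
  have hbound : ∀ N : Submodule (DualAlgebra K C)ᵐᵒᵖ E, S ≤ N → Module.Finite K N →
      Module.finrank K N ≤ Module.finrank K P := by
    intro N hSN hN
    have hNrat : IsRational (DualAlgebra K C)ᵐᵒᵖ N := hE.submodule N
    have hN0 : N ≠ ⊥ := fun h0 => hS.1 (le_bot_iff.1 (h0 ▸ hSN))
    let res : Module.Dual K N →ₗ[DualAlgebra K C] Module.Dual K S :=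
      { toFun := fun v => v ∘ₗ (Submodule.inclusion hSN).restrictScalars K
        map_add' := fun v w => rfl
        map_smul' := fun f v => rfl }
    have hres : Function.Surjective res := LinearMap.dualMap_surjective_of_injective
      (f := (Submodule.inclusion hSN).restrictScalars K) (Submodule.inclusion_injective hSN)
    obtain ⟨q, hq⟩ := hlift _ _ hNrat.leftDual hSrat.leftDual res p hres
    have hqs : q x ⟨s, hSN s.2⟩ ≠ 0 := by
      have h1 : q x ⟨s, hSN s.2⟩ = p x s := LinearMap.congr_fun (hq x) s
      rwa [h1]
    have hqsurj : Function.Surjective (q.restrictScalars K) := fun v => by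
      obtain ⟨f, hf⟩ := (hS.comap_subtype le_top hN0).exists_smul_eq hNrat
        ⟨⟨s, hSN s.2⟩, s.2, hqs⟩ v
      exact ⟨f • x, (q.map_smul f x).trans hf⟩
    rw [← Subspace.dual_finrank_eq]
    exact LinearMap.finrank_le_finrank_of_surjective hqsurj
  obtain ⟨N, ⟨hSN, hN⟩, hmax⟩ := (measure fun N : Submodule (DualAlgebra K C)ᵐᵒᵖ E =>
    Module.finrank K P - Module.finrank K N).wf.has_min
      {N | S ≤ N ∧ Module.Finite K N} ⟨S, le_rfl, hSfin⟩
  have hNtop : N = ⊤ := hE.eq_top_of_forall_finite (K := K) fun N' hN' hNN' => by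
    have h1 := hbound N' (hSN.trans hNN') hN'
    have h2 : ¬ Module.finrank K P - Module.finrank K N' <
      Module.finrank K P - Module.finrank K N := hmax N' ⟨hSN.trans hNN', hN'⟩
    have hfin : Module.Finite K (N'.restrictScalars K) := hN'
    have h3 : N.restrictScalars K = N'.restrictScalars K :=
      Submodule.eq_of_le_of_finrank_le (S₁ := N.restrictScalars K) (S₂ := N'.restrictScalars K)
        hNN' (by change Module.finrank K N' ≤ Module.finrank K N; have := hbound N hSN hN; omega)
    exact (Submodule.restrictScalars_injective K _ _ h3).symm
  have : Module.Finite K E := by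
    rw [hNtop] at hN
    exact Module.Finite.of_surjective
      ((⊤ : Submodule (DualAlgebra K C)ᵐᵒᵖ E).subtype.restrictScalars K)
      fun y => ⟨⟨y, trivial⟩, rfl⟩
  exact hasFiniteLoewyLength_of_finite

end ProjectiveCover

end ComoduleTheory

theorem theorem3p4 (K C : Type u) [Field K] [AddCommGroup C] [Module K C] [Coalgebra K C]
    (hgen : ComoduleTheory.RightGeneratingCondition K C) :
    [ComoduleTheory.SimpleEnvelopesHaveFiniteLoewyLength K C,
      ComoduleTheory.IsRightSemiperfect K C,
      ComoduleTheory.IsRightQcF K C].TFAE ∧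
    ((∃ n : ℕ, ComoduleTheory.coradicalFiltration K C n = ⊤) →
      ComoduleTheory.SimpleEnvelopesHaveFiniteLoewyLength K C ∧
      ComoduleTheory.IsRightSemiperfect K C ∧
      ComoduleTheory.IsRightQcF K C) := by
  refine ⟨?_, fun ⟨n, hn⟩ => ?_⟩
  · tfae_have 1 → 2 := fun h => (hgen.hullsAreFinite_of_envelopes h).isRightSemiperfect
    tfae_have 2 → 1 := fun h => h.simpleEnvelopesHaveFiniteLoewyLength
    tfae_have 1 → 3 := fun h => hgen.isRightQcF (hgen.hullsAreFinite_of_envelopes h)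
    tfae_have 3 → 1 := fun h => h.simpleEnvelopesHaveFiniteLoewyLength
    tfae_finish
  · have h := hgen.hullsAreFinite_of_coradicalFiltration hn
    exact ⟨(hgen.isRightQcF h).simpleEnvelopesHaveFiniteLoewyLength, h.isRightSemiperfect,
      hgen.isRightQcF h⟩
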